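/- **Theorem.** Let $p$ be a prime of the form $p=4x^{2}+27$ with $x\in\mathbb Z$, $x\equiv 1\pmod 3$, and let $g$ be any generator of the cyclic group $\mathbb F_p^{*}$. For $l\ge 0$ put $D_l=g^{l}\langle g^{6}\rangle\subset\mathbb F_p^{*}$, and let $h=\{h_\lambda\}_{\lambda=0}^{p-1}$ be the Hall sequence of period $p$: $h_\lambda=1$ if $\lambda \bmod p\in D_0\cup D_1\cup D_3$ and $h_\lambda=0$ otherwise. Let $M_{-1}(h)$ be the binary sequence of period $p$ with $M_{-1}(h)_\lambda=h_{-\lambda}$. For binary sequences $a,b$ of odd period $n$ (indices modulo $n$, values in $\mathbb F_2=\{0,1\}$), let $w(a,b)=\{w_i\}_{i=0}^{2n-1}$ be the quaternary sequence $w_i=\phi(c_i,d_i)$, where for $0\le j\le n-1$ $$c_{2j}=a_j,\quad c_{2j+1}=a_{\frac{n+1}{2}+j},\qquad d_{2j}=b_j,\quad d_{2j+1}=1-b_{\frac{n+1}{2}+j},$$ and $\phi(0,0)=0$, $\phi(0,1)=1$, $\phi(1,1)=2$, $\phi(1,0)=3$. The 4-adic complexity of a quaternary sequence $s=\{s_i\}_{i=0}^{N-1}$,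 $s_i\in\{0,1,2,3\}$, of period $N$ is $$FC_s(4)=\log_4\frac{4^{N}-1}{\gcd\left(\sum_{i=0}^{N-1}s_i4^{i},\,4^{N}-1\right)}.$$ Then for $w=w(h,M_{-1}(h))$, of period $2p$, $$FC_w(4)=\begin{cases}\log_4\dfrac{4^{2p}-1}{5}, & \text{if } p\equiv 3\pmod 5,\\[2mm] \log_4\left(4^{2p}-1\right), & \text{otherwise.}\end{cases}$$ -/

import Mathlib

namespace InterleavedQuaternary

/-- The Gray map: (0,0) ↦ 0, (0,1) ↦ 1, (1,1) ↦ 2, (1,0) ↦ 3. -/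
def gray (c d : ZMod 2) : ZMod 4 :=
  if c = 0 then (if d = 0 then 0 else 1) else (if d = 0 then 3 else 2)

/-- The binary sequence `a_0, a_{(n+1)/2}, a_1, a_{(n+1)/2+1}, …, a_{n-1}, a_{(n+1)/2+n-1}`
of length `2n` read off from `M_a`, where the indices of `a` are taken modulo `n`. -/
def interleaveLeft {n : ℕ} (a : ZMod n → ZMod 2) (i : Fin (2 * n)) : ZMod 2 :=
  if (i : ℕ) % 2 = 0 then a (((i : ℕ) / 2 : ℕ) : ZMod n)
  else a (((n + 1) / 2 + (i : ℕ) / 2 : ℕ) : ZMod n)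

/-- The binary sequence `b_0, 1 - b_{(n+1)/2}, b_1, 1 - b_{(n+1)/2+1}, …` of length `2n`
read off from `M'_b`, where the indices of `b` are taken modulo `n`. -/
def interleaveRight {n : ℕ} (b : ZMod n → ZMod 2) (i : Fin (2 * n)) : ZMod 2 :=
  if (i : ℕ) % 2 = 0 then b (((i : ℕ) / 2 : ℕ) : ZMod n)
  else 1 - b (((n + 1) / 2 + (i : ℕ) / 2 : ℕ) : ZMod n)

/-- The quaternary sequence `w(a, b)` of period `2n`, interleaved by the binary sequences
`a`, `b` of odd period `n`. -/
def interleave {n : ℕ} (a b : ZMod n → ZMod 2) (i : Fin (2 * n)) : ZMod 4 :=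
  gray (interleaveLeft a i) (interleaveRight b i)

/-- `S(4) = ∑ s_i 4^i`, with the digits `s_i` read as the integers `0, 1, 2, 3`. -/
def valueAtFour {N : ℕ} (s : Fin N → ZMod 4) : ℕ :=
  ∑ i : Fin N, (s i).val * 4 ^ (i : ℕ)

/-- The 4-adic complexity of a quaternary sequence of period `N`. -/
noncomputable def fourAdicComplexity {N : ℕ} (s : Fin N → ZMod 4) : ℝ :=
  Real.logb 4 (((4 : ℝ) ^ N - 1) / (Nat.gcd (valueAtFour s) (4 ^ N - 1) : ℝ))

/-- The `r`-sample sequence `M_r(a)`, `M_r(a)_i = a_{ri}`. -/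
def sample {n : ℕ} (r : (ZMod n)ˣ) (a : ZMod n → ZMod 2) (i : ZMod n) : ZMod 2 :=
  a ((r : ZMod n) * i)

/-- The cyclotomic class `D_l = g^l ⟨g^6⟩` of order 6, as a subset of `ZMod p`. -/
def cyclotomicClass {p : ℕ} (g : (ZMod p)ˣ) (l : ℕ) : Set (ZMod p) :=
  {y | ∃ u ∈ Subgroup.zpowers (g ^ 6), y = ((g ^ l * u : (ZMod p)ˣ) : ZMod p)}

open Classical in
/-- The Hall sequence with respect to `g`: the indicator of `D_0 ∪ D_1 ∪ D_3`. -/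
noncomputable def hall {p : ℕ} (g : (ZMod p)ˣ) (i : ZMod p) : ZMod 2 :=
  if i ∈ cyclotomicClass g 0 ∪ cyclotomicClass g 1 ∪ cyclotomicClass g 3 then 1 else 0

end InterleavedQuaternary

namespace InterleavedQuaternary

/-! The claim is that the gcd of the value at 4 with `4^(2p) - 1` is 5 or 1. A prime `q` dividing it
satisfies `4^p = ±1` mod `q`, and apart from `q = 3, 5` the element 16 has order `p`, so `q = 1 +
2pn` and `ψ t = 16^t` is a primitive additive character in characteristic `q`. The shift by
`(p+1)/2` turns the value at 4 into a sum over `ZMod p` against `ψ`. If `4^p = 1` it is four times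
the Hall sum, and if `4^p = -1` it is the sum of `2·1_C - 1` for a coset `C` of the cubes.

Both sums are combinations of Gauss sums of order dividing 6. Write the cubic Jacobi sum as `a +
bω`. The form of `p` forces `b = ±6`, hence 4 is a cube, and this gives `J(χ,χ) = J(χ,η)` for the
quadratic character `η`, so the sextic Gauss sums reduce to cubic and quadratic ones. Elimination
turns vanishing mod `q` into divisibility by `q` of an explicit integer: `p + 1` or `p^3 - 13p^2 +
115p + 1` for the Hall sum (`sum_hall_ne_zero`), `p(2a - b + 3) - 1` for the other
(`sum_gray_sub_ne_zero`). Size and congruences mod `p` exclude these, up to two numerical cases. The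
primes 3 and 5, where `ψ` is trivial, are settled by counting, and 25 by a computation of powers. -/

/-- Uniqueness of the representation `4 p = c ^ 2 + 27 d ^ 2`, for `p = 4 x ^ 2 + 27`. -/
theorem eq_six_or_eq_neg_six_of_norm_eq {p : ℕ} (hp : p.Prime) {x a b : ℤ} (hpx : (p : ℤ) = 4 * x ^ 2 + 27)
    (hab : a ^ 2 - a * b + b ^ 2 = p) (hb : 3 ∣ b) : b = 6 ∨ b = -6 := by
  obtain ⟨d, rfl⟩ := hb
  obtain ⟨c, hc⟩ : ∃ c, c = 2 * a - 3 * d := ⟨_, rfl⟩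
  have h4 : c ^ 2 + 27 * d ^ 2 = 4 * p := by rw [hc, ← hab]; ring
  have hpos : (0 : ℤ) < p := by exact_mod_cast hp.pos
  have key : ∀ e : ℤ, (e = x ∨ e = -x) → (p : ℤ) ∣ c - 2 * e * d → d ^ 2 = 4 := by
    intro e he hdvd
    have he2 : e ^ 2 = x ^ 2 := by rcases he with rfl | rfl <;> ring
    -- Composition of `4p = c^2 + 27d^2` with `4p = (4e)^2 + 27·2^2`. A nonzero multiple of `p` in
    -- the second square would contribute at least `108p^2 > 16p^2`.
    have hB : (c * (4 * e) + 54 * d) ^ 2 + 27 * (2 * (c - 2 * e * d)) ^ 2 = 16 * (p : ℤ) ^ 2 := by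
      have : 4 * (p : ℤ) = (4 * e) ^ 2 + 27 * 2 ^ 2 := by rw [hpx, ← he2]; ring
      calc _ = ((4 * e) ^ 2 + 27 * 2 ^ 2) * (c ^ 2 + 27 * d ^ 2) := by ring
        _ = _ := by rw [← this, h4]; ring
    obtain ⟨m, hm⟩ := hdvd
    have hm0 : m = 0 := by
      by_contra hne
      have h1 : 0 < m ^ 2 := by positivity
      rw [hm] at hB
      nlinarith [sq_nonneg (c * (4 * e) + 54 * d), mul_pos hpos hpos]
    have hcd : c = 2 * e * d := by rw [hm0] at hm; linarith
    have : (p : ℤ) * d ^ 2 = p * 4 := by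
      rw [hcd] at h4
      rw [hpx]
      rw [hpx] at h4
      linear_combination h4 - 4 * d ^ 2 * he2
    exact mul_left_cancel₀ hpos.ne' this
  have hd2 : d ^ 2 = 4 := by
    have hdiv : (p : ℤ) ∣ (c - 2 * x * d) * (c - 2 * (-x) * d) := by
      refine ⟨4 - d ^ 2, ?_⟩
      rw [hpx] at h4 ⊢
      linear_combination h4
    rcases (Nat.prime_iff_prime_int.1 hp).dvd_or_dvd hdiv with h | h
    · exact key x (Or.inl rfl) h
    · exact key (-x) (Or.inr rfl) h
  have : (d - 2) * (d + 2) = 0 := by linear_combination hd2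
  rcases mul_eq_zero.1 this with h | h
  · left; linarith
  · right; linarith

/-! ### The cubic Jacobi sum, and 4 as a cube modulo `p`. -/

section CubicCharacter

variable {p : ℕ} [Fact p.Prime] {g : (ZMod p)ˣ}

theorem exists_pow_eq_of_generator (hg : ∀ u, u ∈ Subgroup.zpowers g) (u : (ZMod p)ˣ) :
    ∃ k : ℕ, g ^ k = u := by
  obtain ⟨k, hk⟩ := mem_powers_iff_mem_zpowers.2 (hg u)
  exact ⟨k, hk⟩

theorem cube_eq_one_of_root {K : Type*} [CommRing K] {ω : K} (hω : ω ^ 2 + ω + 1 = 0) :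
    ω ^ 3 = 1 := by
  linear_combination (ω - 1) * hω

/-- A multiplicative character is determined by prescribing an `n`-th root of unity as its value
at a generator, for `n ∣ p - 1`. -/
theorem exists_mulChar_apply_generator (hg : ∀ u, u ∈ Subgroup.zpowers g) {K : Type*} [Field K]
    {n : ℕ} (hn : n ∣ p - 1) {ζ : K} (hζ : ζ ^ n = 1) :
    ∃ χ : MulChar (ZMod p) K, χ g = ζ := by
  have hpp : p - 1 ≠ 0 := by have := (Fact.out : p.Prime).two_le; omega
  obtain ⟨m, hm⟩ := hn
  have h1 : ζ ^ (p - 1) = 1 := by rw [hm, pow_mul, hζ, one_pow]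
  let z : Kˣ := Units.ofPowEqOne ζ (p - 1) h1 hpp
  have hz : z ∈ rootsOfUnity (Fintype.card (ZMod p)ˣ) K := by
    rw [mem_rootsOfUnity, ZMod.card_units]
    ext
    simp [z]
  refine ⟨MulChar.ofRootOfUnity hz hg, ?_⟩
  rw [MulChar.ofRootOfUnity_spec]
  rfl

theorem mulChar_apply_generator_pow {K : Type*} [Field K] {ζ : K} {χ : MulChar (ZMod p) K}
    (hχ : χ g = ζ) (k : ℕ) : χ ((g ^ k : (ZMod p)ˣ) : ZMod p) = ζ ^ k := by
  rw [Units.val_pow_eq_pow_val, map_pow, hχ]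

theorem mulChar_pow_eq_one_of_generator (hg : ∀ u, u ∈ Subgroup.zpowers g) {K : Type*} [Field K]
    {n : ℕ} {ζ : K} (hζ : ζ ^ n = 1) {χ : MulChar (ZMod p) K} (hχ : χ g = ζ) : χ ^ n = 1 := by
  rw [MulChar.eq_one_iff]
  intro u
  obtain ⟨k, rfl⟩ := exists_pow_eq_of_generator hg u
  rw [MulChar.pow_apply_coe, mulChar_apply_generator_pow hχ, ← pow_mul, mul_comm, pow_mul, hζ,
    one_pow]

theorem mulChar_ne_one_of_generator {K : Type*} [Field K]
    {ζ : K} (hζ : ζ ≠ 1) {χ : MulChar (ZMod p) K} (hχ : χ g = ζ) : χ ≠ 1 :=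
  MulChar.ne_one_iff.2 ⟨g, by rwa [hχ]⟩

theorem isPrimitiveRoot_three {K : Type*} [Field K] (h3 : (3 : K) ≠ 0) {ω : K}
    (hω : ω ^ 2 + ω + 1 = 0) : IsPrimitiveRoot ω 3 := by
  refine IsPrimitiveRoot.iff_orderOf.2 (orderOf_eq_prime (cube_eq_one_of_root hω) ?_)
  rintro rfl
  exact h3 (by linear_combination hω)

open Polynomial in
/-- The Jacobi sum of the cubic character with itself is `a + b ω` with rational integers `a`, `b`
that depend only on the generator and not on the field of values. -/
theorem exists_int_jacobiSum_eq (hg : ∀ u, u ∈ Subgroup.zpowers g) :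
    ∃ a b : ℤ, ∀ (K : Type) [Field K] (ω : K) (χ : MulChar (ZMod p) K),
      ω ^ 2 + ω + 1 = 0 → χ g = ω → jacobiSum χ χ = a + b * ω := by
  classical
  -- Discrete logarithm; its value at 0 is irrelevant because the Jacobi sum is taken over `t ≠ 0,
  -- 1`. Its exponents define one integer polynomial, reduced mod `X^2 + X + 1`, which serves every
  -- field.
  have hind : ∀ t : ZMod p, ∃ k : ℕ, t ≠ 0 → (g : ZMod p) ^ k = t := by
    intro t
    by_cases ht : t = 0
    · exact ⟨0, fun h => (h ht).elim⟩
    · obtain ⟨k, hk⟩ := exists_pow_eq_of_generator hg (Units.mk0 t ht)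
      refine ⟨k, fun _ => ?_⟩
      rw [← Units.val_pow_eq_pow_val, hk, Units.val_mk0]
  choose ind hind using hind
  let P : ℤ[X] := ∑ t ∈ Finset.univ \ {0, 1}, X ^ (ind t + ind (1 - t))
  let M : ℤ[X] := X ^ 2 + X + 1
  have hM : M.Monic := by unfold M; monicity!
  have hMdeg : M.natDegree = 2 := by unfold M; compute_degree!
  have hdeg : (P %ₘ M).natDegree ≤ 1 := by
    have := natDegree_modByMonic_lt P hM (by intro h; rw [h] at hMdeg; simp at hMdeg)
    omega
  refine ⟨(P %ₘ M).coeff 0, (P %ₘ M).coeff 1, ?_⟩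
  intro K _ ω χ hω hχ
  have h1 : jacobiSum χ χ = aeval ω P := by
    rw [jacobiSum_eq_sum_sdiff, map_sum]
    refine Finset.sum_congr rfl fun t ht => ?_
    simp only [Finset.mem_sdiff, Finset.mem_univ, true_and, Finset.mem_insert,
      Finset.mem_singleton, not_or] at ht
    rw [map_pow, aeval_X, pow_add, ← hχ, ← map_pow, ← map_pow, hind t ht.1,
      hind (1 - t) (sub_ne_zero.2 (Ne.symm ht.2))]
  have h2 : aeval ω P = aeval ω (P %ₘ M) := by
    conv_lhs => rw [← modByMonic_add_div P M]
    have : aeval ω M = 0 := by simpa [M] using hω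
    rw [map_add, map_mul, this, zero_mul, add_zero]
  rw [h1, h2]
  conv_lhs => rw [eq_X_add_C_of_natDegree_le_one hdeg]
  simp
  ring

theorem exists_root_of_two_three {K : Type*} [Field K] [IsAlgClosed K] :
    ∃ ω : K, ω ^ 2 + ω + 1 = 0 := by
  obtain ⟨ω, h⟩ := IsAlgClosed.exists_root (Polynomial.X ^ 2 + Polynomial.X + 1 : Polynomial K) (by
    have : (Polynomial.X ^ 2 + Polynomial.X + 1 : Polynomial K).degree = 2 := by compute_degree!
    rw [this]; decide)
  exact ⟨ω, by simpa [Polynomial.IsRoot] using h⟩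

theorem int_add_mul_omega_injective {ω : ℂ} (hω : ω ^ 2 + ω + 1 = 0) {a b c d : ℤ}
    (h : (a : ℂ) + b * ω = c + d * ω) : a = c ∧ b = d := by
  have him : ω.im ≠ 0 := by
    intro him
    have hre := congrArg Complex.re hω
    simp [pow_two, him] at hre
    nlinarith [sq_nonneg (2 * ω.re + 1)]
  have h1 := congrArg Complex.im h
  have h2 := congrArg Complex.re h
  simp [him] at h1 h2
  subst h1
  refine ⟨?_, rfl⟩
  simpa using h2

theorem exists_int_of_mem_adjoin {ω : ℂ} (hω : ω ^ 2 + ω + 1 = 0) {z : ℂ}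
    (hz : z ∈ Algebra.adjoin ℤ {ω}) : ∃ m n : ℤ, z = m + n * ω := by
  induction hz using Algebra.adjoin_induction with
  | mem x hx => exact ⟨0, 1, by simpa using hx⟩
  | algebraMap r => exact ⟨r, 0, by simp⟩
  | add x y _ _ hx hy =>
    obtain ⟨m, n, rfl⟩ := hx
    obtain ⟨k, l, rfl⟩ := hy
    exact ⟨m + k, n + l, by push_cast; ring⟩
  | mul x y _ _ hx hy =>
    obtain ⟨m, n, rfl⟩ := hx
    obtain ⟨k, l, rfl⟩ := hy
    exact ⟨m * k - n * l, m * l + n * k - n * l, by push_cast; linear_combination (n * l : ℂ) * hω⟩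

/-- The norm of the cubic Jacobi sum `a + b ω` is `p`, and `b` is divisible by `3`. -/
theorem jacobiSum_norm_and_three_dvd (hg : ∀ u, u ∈ Subgroup.zpowers g) (h3 : 3 ∣ p - 1) {a b : ℤ}
    (hab : ∀ (K : Type) [Field K] (ω : K) (χ : MulChar (ZMod p) K),
      ω ^ 2 + ω + 1 = 0 → χ g = ω → jacobiSum χ χ = a + b * ω) :
    a ^ 2 - a * b + b ^ 2 = p ∧ 3 ∣ b := by
  obtain ⟨ω, hω⟩ := exists_root_of_two_three (K := ℂ)
  have hω3 := cube_eq_one_of_root hω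
  have h3' : (3 : ℂ) ≠ 0 := by norm_num
  have hprim := isPrimitiveRoot_three h3' hω
  obtain ⟨χ, hχ⟩ := exists_mulChar_apply_generator hg h3 hω3
  have hχ3 := mulChar_pow_eq_one_of_generator hg hω3 hχ
  have hω1 : ω ≠ 1 := by
    rintro rfl
    exact h3' (by linear_combination hω)
  have hω2 : ω ^ 2 ≠ 1 := by
    intro h
    apply hω1
    linear_combination hω3 - ω * h
  have hne : χ ≠ 1 := mulChar_ne_one_of_generator hω1 hχ
  have hχ2 : (χ * χ) g = ω ^ 2 := by rw [MulChar.mul_apply, hχ, sq]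
  have hne2 : χ * χ ≠ 1 := mulChar_ne_one_of_generator hω2 hχ2
  have hinv : χ⁻¹ = χ * χ := by
    rw [inv_eq_iff_mul_eq_one, ← hχ3, pow_succ', sq]
  have hω' : (ω ^ 2) ^ 2 + ω ^ 2 + 1 = 0 := by linear_combination (ω ^ 2 - ω + 1) * hω
  have hJ := hab ℂ ω χ hω hχ
  have hJ' := hab ℂ (ω ^ 2) (χ * χ) hω' hχ2
  have hchar : ringChar ℂ ≠ ringChar (ZMod p) := by
    rw [ZMod.ringChar_zmod_n, ringChar.eq_zero]
    exact (Fact.out : p.Prime).ne_zero.symm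
  have hmul := jacobiSum_mul_jacobiSum_inv hchar hne hne hne2
  rw [hinv, hJ, hJ', ZMod.card] at hmul
  refine ⟨?_, ?_⟩
  · have : ((a ^ 2 - a * b + b ^ 2 : ℤ) : ℂ) = ((p : ℤ) : ℂ) := by
      push_cast
      rw [← hmul]
      linear_combination (-a * b : ℂ) * hω - (b ^ 2 : ℂ) * hω3
    exact_mod_cast this
  -- `J ≡ -1` modulo `(ω - 1)^2 = -3ω`, so the coefficient of `ω` is a multiple of 3.
  · obtain ⟨z, hz, hJz⟩ := exists_jacobiSum_eq_neg_one_add (F := ZMod p) (n := 3) (by norm_num)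
      hχ3 hχ3 (by rwa [ZMod.card]) hprim
    obtain ⟨m, n, rfl⟩ := exists_int_of_mem_adjoin hω hz
    rw [hJ] at hJz
    have h : (a : ℂ) + b * ω = ((-1 + 3 * n : ℤ) : ℂ) + ((3 * n - 3 * m : ℤ) : ℂ) * ω := by
      rw [hJz]
      push_cast
      linear_combination (m + n * ω - 3 * n : ℂ) * hω
    obtain ⟨rfl, rfl⟩ := int_add_mul_omega_injective hω h
    exact ⟨n - m, by ring⟩

/-- `4` is a cube modulo `p` as soon as the coefficient `b` of the cubic Jacobi sum is even. -/
theorem exists_cube_eq_four (hg : ∀ u, u ∈ Subgroup.zpowers g) (h3 : 3 ∣ p - 1) (hp2 : p ≠ 2)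
    {a b : ℤ}
    (hab : ∀ (K : Type) [Field K] (ω : K) (χ : MulChar (ZMod p) K),
      ω ^ 2 + ω + 1 = 0 → χ g = ω → jacobiSum χ χ = a + b * ω)
    (ha : Odd a) (hb : Even b) : ∃ y : ZMod p, y ^ 3 = 4 := by
  have : Fact (Nat.Prime 2) := ⟨Nat.prime_two⟩
  let K := AlgebraicClosure (ZMod 2)
  have : CharP K 2 := charP_of_injective_algebraMap (algebraMap (ZMod 2) K).injective 2
  obtain ⟨ω, hω⟩ := exists_root_of_two_three (K := K)
  have h3' : (3 : K) ≠ 0 := by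
    have : (3 : K) = 1 := by linear_combination CharP.cast_eq_zero K 2
    rw [this]; exact one_ne_zero
  have hω3 := cube_eq_one_of_root hω
  have hprim := isPrimitiveRoot_three h3' hω
  obtain ⟨χ, hχ⟩ := exists_mulChar_apply_generator hg h3 hω3
  have hJ := hab K ω χ hω hχ
  have htwo : (2 : ZMod p) ≠ 0 := by
    intro h
    have : ((2 : ℕ) : ZMod p) = 0 := by exact_mod_cast h
    rw [ZMod.natCast_eq_zero_iff] at this
    exact hp2 ((Nat.prime_dvd_prime_iff_eq Fact.out Nat.prime_two).1 this)
  -- In characteristic 2 the terms at `t` and `1 - t` cancel, leaving only the fixed point `t =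
  -- 1/2`. With `a` odd and `b` even this yields `χ(1/4) = 1`.
  have hsum : jacobiSum χ χ = χ 2⁻¹ * χ 2⁻¹ := by
    rw [jacobiSum, ← Finset.add_sum_erase _ _ (Finset.mem_univ (2⁻¹ : ZMod p))]
    have h12 : (1 : ZMod p) - 2⁻¹ = 2⁻¹ := by field_simp; ring
    rw [h12, Finset.sum_involution (fun t _ => 1 - t), add_zero]
    · intro t _
      rw [sub_sub_cancel, mul_comm (χ (1 - t))]
      exact CharTwo.add_self_eq_zero _
    · intro t ht _ h
      apply (Finset.mem_erase.1 ht).1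
      field_simp
      linear_combination -h
    · intro t ht
      refine Finset.mem_erase.2 ⟨fun h => (Finset.mem_erase.1 ht).1 ?_, Finset.mem_univ _⟩
      rw [← h12, ← h]; ring
    · intro t _
      ring
  have ha1 : (a : K) = 1 := by
    obtain ⟨m, rfl⟩ := ha
    have hm : ((2 * m : ℤ) : K) = 0 := (CharP.intCast_eq_zero_iff K 2 _).2 (dvd_mul_right _ _)
    rw [Int.cast_add, hm, zero_add, Int.cast_one]
  have hb1 : (b : K) = 0 := (CharP.intCast_eq_zero_iff K 2 _).2 hb.two_dvd
  rw [ha1, hb1, zero_mul, add_zero, hsum] at hJ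
  obtain ⟨k, hk⟩ := exists_pow_eq_of_generator hg (Units.mk0 (2⁻¹ * 2⁻¹ : ZMod p)
    (mul_ne_zero (inv_ne_zero htwo) (inv_ne_zero htwo)))
  have hk' : ω ^ k = 1 := by
    rw [← mulChar_apply_generator_pow hχ, hk, Units.val_mk0, map_mul, hJ]
  obtain ⟨m, rfl⟩ := (hprim.pow_eq_one_iff_dvd k).1 hk'
  refine ⟨((g ^ m : (ZMod p)ˣ) : ZMod p)⁻¹, ?_⟩
  have h4 : ((g ^ m : (ZMod p)ˣ) : ZMod p) ^ 3 = 2⁻¹ * 2⁻¹ := by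
    rw [← Units.val_pow_eq_pow_val, ← pow_mul, mul_comm, hk, Units.val_mk0]
  rw [inv_pow, h4]
  field_simp
  norm_num

end CubicCharacter

/-! ### Character expansions of the Hall indicator and of the Gray difference. -/

section HallIndicator

variable {p : ℕ} [Fact p.Prime] {g : (ZMod p)ˣ}

theorem orderOf_generator (hg : ∀ u, u ∈ Subgroup.zpowers g) : orderOf g = p - 1 := by
  rw [orderOf_eq_card_of_forall_mem_zpowers hg, Nat.card_eq_fintype_card, ZMod.card_units]

theorem pow_mem_cyclotomicClass_iff (hg : ∀ u, u ∈ Subgroup.zpowers g) (h6 : 6 ∣ p - 1)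
    (k l : ℕ) : ((g ^ k : (ZMod p)ˣ) : ZMod p) ∈ cyclotomicClass g l ↔ k ≡ l [MOD 6] := by
  simp only [cyclotomicClass, Set.mem_ofPred_eq, Units.val_inj]
  constructor
  · rintro ⟨u, hu, h⟩
    obtain ⟨m, rfl⟩ := Subgroup.mem_zpowers_iff.1 hu
    have h' : g ^ (k : ℤ) = g ^ ((l : ℤ) + 6 * m) := by
      rw [zpow_add, zpow_mul]; exact_mod_cast h
    rw [zpow_eq_zpow_iff_modEq, orderOf_generator hg] at h'
    have h'' := h'.of_dvd (Int.natCast_dvd_natCast.2 h6)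
    rw [← Int.natCast_modEq_iff]
    refine h''.trans ?_
    rw [Int.modEq_iff_dvd]
    exact ⟨-m, by push_cast; ring⟩
  · intro h
    obtain ⟨m, hm⟩ := Int.modEq_iff_dvd.1 ((Int.natCast_modEq_iff).2 h.symm)
    refine ⟨(g ^ 6) ^ m, Subgroup.zpow_mem_zpowers _ _, ?_⟩
    have h' : g ^ (k : ℤ) = g ^ ((l : ℤ) + 6 * m) := by
      congr 1; push_cast at hm; linarith
    rw [zpow_add, zpow_mul] at h'
    exact_mod_cast h'

theorem zero_notMem_cyclotomicClass (l : ℕ) : (0 : ZMod p) ∉ cyclotomicClass g l := by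
  rintro ⟨u, _, h⟩
  exact (g ^ l * u).ne_zero h.symm

theorem hall_zero : hall g 0 = 0 := by
  simp [hall, zero_notMem_cyclotomicClass]

theorem hall_pow (hg : ∀ u, u ∈ Subgroup.zpowers g) (h6 : 6 ∣ p - 1) (k : ℕ) :
    hall g ((g ^ k : (ZMod p)ˣ) : ZMod p) =
      if k % 6 = 0 ∨ k % 6 = 1 ∨ k % 6 = 3 then 1 else 0 := by
  simp only [hall, Set.mem_union, pow_mem_cyclotomicClass_iff hg h6, Nat.ModEq, or_assoc]

theorem neg_one_eq_pow (hg : ∀ u, u ∈ Subgroup.zpowers g) (hp2 : p ≠ 2) :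
    (-1 : (ZMod p)ˣ) = g ^ ((p - 1) / 2) := by
  have hp := (Fact.out : p.Prime)
  have hodd := hp.eq_two_or_odd.resolve_left hp2
  have h2 := hp.two_le
  have hsq : g ^ ((p - 1) / 2) * g ^ ((p - 1) / 2) = 1 := by
    rw [← pow_add, show (p - 1) / 2 + (p - 1) / 2 = p - 1 by omega, ← orderOf_generator hg,
      pow_orderOf_eq_one]
  have hne : g ^ ((p - 1) / 2) ≠ 1 := by
    intro h
    have := Nat.le_of_dvd (by omega) (orderOf_dvd_of_pow_eq_one h)
    rw [orderOf_generator hg] at this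
    omega
  have h' : ((g ^ ((p - 1) / 2) : (ZMod p)ˣ) : ZMod p) * ((g ^ ((p - 1) / 2) : (ZMod p)ˣ) : ZMod p)
      = 1 := by rw [← Units.val_mul, hsq, Units.val_one]
  rcases mul_self_eq_one_iff.1 h' with h1 | h1
  · exact (hne (Units.ext h1)).elim
  · exact Units.ext h1.symm

theorem neg_pow_eq (hg : ∀ u, u ∈ Subgroup.zpowers g) (hp2 : p ≠ 2) (k : ℕ) :
    -((g ^ k : (ZMod p)ˣ) : ZMod p) = ((g ^ (k + (p - 1) / 2) : (ZMod p)ˣ) : ZMod p) := by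
  rw [pow_add, ← neg_one_eq_pow hg hp2]
  simp

variable {K : Type*} [Field K] {ω : K} {χ e : MulChar (ZMod p) K}

/-- The first bracket detects the cubes `D_0 ∪ D_3`, the second the coset `D_1 ∪ D_4`; subtracting
the twist by the quadratic character `e` keeps only the nonsquares `D_1` of that coset. -/
theorem six_mul_hall_val (hg : ∀ u, u ∈ Subgroup.zpowers g) (h6 : 6 ∣ p - 1)
    (hω : ω ^ 2 + ω + 1 = 0) (hχ : χ g = ω) (he : e g = -1) (t : ZMod p) :
    6 * ((hall g t).val : K) =
      2 * ((1 : MulChar (ZMod p) K) t + χ t + (χ * χ) t)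
      + ((1 : MulChar (ZMod p) K) t + ω ^ 2 * χ t + ω * (χ * χ) t)
      - (e t + ω ^ 2 * (χ * e) t + ω * ((χ * χ) * e) t) := by
  by_cases ht : t = 0
  · subst ht
    rw [hall_zero]
    simp [MulChar.map_zero]
  · obtain ⟨k, hk⟩ := exists_pow_eq_of_generator hg (Units.mk0 t ht)
    have htk : t = ((g ^ k : (ZMod p)ˣ) : ZMod p) := by rw [hk, Units.val_mk0]
    rw [htk]
    simp only [MulChar.mul_apply, mulChar_apply_generator_pow hχ, mulChar_apply_generator_pow he,
      MulChar.one_apply_coe, hall_pow hg h6]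
    have hω3 := cube_eq_one_of_root hω
    have hk6 : k = 6 * (k / 6) + k % 6 := (Nat.div_add_mod k 6).symm
    have hωk : ω ^ k = ω ^ (k % 6) := by
      conv_lhs => rw [hk6, pow_add, pow_mul, show ω ^ 6 = 1 by linear_combination (ω ^ 3 + 1) * hω3]
      rw [one_pow, one_mul]
    have hek : (-1 : K) ^ k = (-1) ^ (k % 6) := by
      conv_lhs => rw [hk6, pow_add, pow_mul, show (-1 : K) ^ 6 = 1 by norm_num]
      rw [one_pow, one_mul]
    rw [hωk, hek]
    have hlt : k % 6 < 6 := Nat.mod_lt _ (by norm_num)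
    have hv : ((1 : ZMod 2).val : K) = 1 := by simp [ZMod.val_one]
    have hv0 : ((0 : ZMod 2).val : K) = 0 := by simp
    have hω2 : ω ^ 2 = -1 - ω := by linear_combination hω
    have hω4 : ω ^ 4 = ω := by linear_combination ω * hω3
    have hω5 : ω ^ 5 = -1 - ω := by linear_combination ω ^ 2 * hω3 + hω
    generalize k % 6 = r at *
    interval_cases r <;> norm_num [hv, hv0, hω2, hω3, hω4, hω5] <;>
      ring_nf <;> norm_num [hω2, hω3, hω4, hω5] <;> ring

/-- The difference of the Gray values attached to the Hall sequence and its reflection is, up to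
the constant `-1`, twice the indicator of a cubic residue class. -/
theorem three_mul_gray_sub (hg : ∀ u, u ∈ Subgroup.zpowers g) (h12 : p % 12 = 7)
    (hω : ω ^ 2 + ω + 1 = 0) (hχ : χ g = ω) (t : ZMod p) :
    3 * (((gray (hall g t) (hall g (-t))).val : K) - (gray (hall g t) (1 - hall g (-t))).val) =
      2 * ((1 : MulChar (ZMod p) K) t + ω ^ 2 * χ t + ω * (χ * χ) t) - 3 := by
  have h6 : 6 ∣ p - 1 := by omega
  have hv0 : (gray 0 0).val = 0 := by decide
  have hv1 : (gray 0 1).val = 1 := by decide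
  have hv2 : (gray 1 0).val = 3 := by decide
  have hv3 : (gray 1 1).val = 2 := by decide
  by_cases ht : t = 0
  · subst ht
    rw [neg_zero, hall_zero]
    simp [hv0, hv1, MulChar.map_zero]
  · obtain ⟨k, hk⟩ := exists_pow_eq_of_generator hg (Units.mk0 t ht)
    have htk : t = ((g ^ k : (ZMod p)ˣ) : ZMod p) := by rw [hk, Units.val_mk0]
    rw [htk, neg_pow_eq hg (by omega)]
    simp only [MulChar.mul_apply, mulChar_apply_generator_pow hχ, MulChar.one_apply_coe,
      hall_pow hg h6]
    -- As `p ≡ 7` mod 12, `(p - 1)/2 ≡ 3` mod 6: negation sends `D_l` to `D_{l+3}`.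
    have hmod : (k + (p - 1) / 2) % 6 = (k % 6 + 3) % 6 := by omega
    rw [hmod]
    have hω3 := cube_eq_one_of_root hω
    have hk6 : k = 6 * (k / 6) + k % 6 := (Nat.div_add_mod k 6).symm
    have hωk : ω ^ k = ω ^ (k % 6) := by
      conv_lhs => rw [hk6, pow_add, pow_mul, show ω ^ 6 = 1 by linear_combination (ω ^ 3 + 1) * hω3]
      rw [one_pow, one_mul]
    rw [hωk]
    have hlt : k % 6 < 6 := Nat.mod_lt _ (by norm_num)
    have hω2 : ω ^ 2 = -1 - ω := by linear_combination hω
    have hω4 : ω ^ 4 = ω := by linear_combination ω * hω3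
    have hω5 : ω ^ 5 = -1 - ω := by linear_combination ω ^ 2 * hω3 + hω
    clear hk htk hmod hωk hk6
    generalize k % 6 = r at *
    interval_cases r <;> norm_num [hv0, hv1, hv2, hv3, hω2, hω3, hω4, hω5] <;>
      ring_nf <;> norm_num [hω2, hω3, hω4, hω5] <;> ring

end HallIndicator

/-! ### The quadratic character, and Jacobi and Gauss sum identities. -/

section GaussSums

variable {p : ℕ} [Fact p.Prime] {K : Type*} [Field K]

/-- The quadratic character of `ZMod p` with values in `K`. -/
def quadChar (p : ℕ) [Fact p.Prime] (K : Type*) [Field K] : MulChar (ZMod p) K :=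
  (quadraticChar (ZMod p)).ringHomComp (Int.castRingHom K)

theorem quadChar_apply_generator {g : (ZMod p)ˣ} (hg : ∀ u, u ∈ Subgroup.zpowers g)
    (hp2 : p ≠ 2) : quadChar p K g = -1 := by
  have h : quadraticChar (ZMod p) g = -1 := by
    by_contra hne
    have h1 : quadraticChar (ZMod p) g = 1 := by
      by_contra h1
      exact hne ((quadraticChar_eq_neg_one_iff_not_one g.ne_zero).2 h1)
    apply quadraticChar_ne_one (F := ZMod p) (by rwa [ZMod.ringChar_zmod_n])
    rw [MulChar.eq_one_iff]
    intro u
    obtain ⟨k, rfl⟩ := exists_pow_eq_of_generator hg u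
    rw [Units.val_pow_eq_pow_val, map_pow, h1, one_pow]
  simp [quadChar, MulChar.ringHomComp_apply, h]

/-- If `χ 4 = 1`, the Jacobi sums `J(χ, χ)` and `J(χ, η)`, with `η` the quadratic character,
coincide. -/
theorem jacobiSum_self_eq_jacobiSum_quadChar (hp2 : p ≠ 2) {χ : MulChar (ZMod p) K} (hχ : χ ≠ 1)
    (h4 : χ 4 = 1) : jacobiSum χ χ = jacobiSum χ (quadChar p K) := by
  have htwo : (2 : ZMod p) ≠ 0 := by
    intro h
    have : ((2 : ℕ) : ZMod p) = 0 := by exact_mod_cast h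
    rw [ZMod.natCast_eq_zero_iff] at this
    exact hp2 ((Nat.prime_dvd_prime_iff_eq Fact.out Nat.prime_two).1 this)
  -- Completing the square: `4t(1 - t) = 1 - (2t - 1)^2`. The values `w = v^2` are then counted with
  -- multiplicity `1 + η(w)`.
  let E : ZMod p ≃ ZMod p :=
    { toFun := fun t => 2 * t - 1
      invFun := fun v => (v + 1) / 2
      left_inv := fun t => by field_simp; ring
      right_inv := fun v => by field_simp; ring }
  have h1 : jacobiSum χ χ = ∑ v : ZMod p, χ (1 - v ^ 2) := by
    rw [← E.sum_comp, jacobiSum]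
    refine Finset.sum_congr rfl fun t _ => ?_
    have : 1 - (E t) ^ 2 = 4 * (t * (1 - t)) := by
      change 1 - (2 * t - 1) ^ 2 = _
      ring
    rw [this, map_mul, map_mul, h4, one_mul]
  have h2 : ∑ v : ZMod p, χ (1 - v ^ 2) = ∑ w : ZMod p, (quadChar p K w + 1) * χ (1 - w) := by
    rw [← Finset.sum_fiberwise Finset.univ (fun v : ZMod p => v ^ 2)]
    refine Finset.sum_congr rfl fun w _ => ?_
    rw [Finset.sum_congr rfl (g := fun _ => χ (1 - w))
      (fun v hv => by rw [(Finset.mem_filter.1 hv).2]), Finset.sum_const, nsmul_eq_mul]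
    congr 1
    have h3 := quadraticChar_card_sqrts (F := ZMod p) (by rwa [ZMod.ringChar_zmod_n]) w
    have h4 : (Finset.univ.filter fun v : ZMod p => v ^ 2 = w) = {x | x ^ 2 = w}.toFinset := by
      ext; simp
    rw [h4]
    have h5 := congrArg (Int.cast : ℤ → K) h3
    push_cast at h5
    rw [h5]
    rfl
  have h3 : ∑ w : ZMod p, χ (1 - w) = 0 := by
    rw [← MulChar.sum_eq_zero_of_ne_one hχ, ← (Equiv.subLeft (1 : ZMod p)).sum_comp]
    simp
  rw [h1, h2, jacobiSum_comm χ, jacobiSum]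
  simp only [add_mul, one_mul, Finset.sum_add_distrib, h3, add_zero]

theorem gaussSum_mul_gaussSum_inv_eq_card {χ : MulChar (ZMod p) K} (hχ : χ ≠ 1)
    (hneg : χ (-1) = 1) {ψ : AddChar (ZMod p) K} (hψ : ψ.IsPrimitive) :
    gaussSum χ ψ * gaussSum χ⁻¹ ψ = p := by
  have hneg' : χ⁻¹ (-1) = 1 := by rw [MulChar.inv_apply', inv_neg, inv_one, hneg]
  rw [← mul_gaussSum_inv_eq_gaussSum χ⁻¹, hneg', one_mul, gaussSum_mul_gaussSum_eq_card hχ hψ,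
    ZMod.card]

end GaussSums

/-! ### The two character sums in Gauss sums, and elimination when they vanish. -/

section Evaluation

variable {p : ℕ} [Fact p.Prime] {g : (ZMod p)ˣ} {K : Type} [Field K] {ω : K}
  {χ : MulChar (ZMod p) K} {ψ : AddChar (ZMod p) K} {a b : ℤ}

/-- The relations between the Gauss sums of order dividing `6`. -/
theorem gaussSum_relations (hg : ∀ u, u ∈ Subgroup.zpowers g) (h12 : p % 12 = 7)
    (h2 : (2 : K) ≠ 0) (h3 : (3 : K) ≠ 0) (hω : ω ^ 2 + ω + 1 = 0) (hχ : χ g = ω)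
    (hψ : ψ.IsPrimitive) (h4 : ∃ y : ZMod p, y ^ 3 = 4)
    (hab : ∀ (K : Type) [Field K] (ω : K) (χ : MulChar (ZMod p) K),
      ω ^ 2 + ω + 1 = 0 → χ g = ω → jacobiSum χ χ = a + b * ω) :
    gaussSum χ ψ * gaussSum (χ * χ) ψ = p ∧
    gaussSum χ ψ ^ 2 = (a + b * ω) * gaussSum (χ * χ) ψ ∧
    gaussSum (χ * χ) ψ ^ 2 = (a + b * ω ^ 2) * gaussSum χ ψ ∧
    gaussSum χ ψ * gaussSum (quadChar p K) ψ = (a + b * ω) * gaussSum (χ * quadChar p K) ψ ∧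
    gaussSum (χ * χ) ψ * gaussSum (quadChar p K) ψ =
      (a + b * ω ^ 2) * gaussSum (χ * χ * quadChar p K) ψ ∧
    gaussSum (quadChar p K) ψ ^ 2 = -p := by
  have hp2 : p ≠ 2 := by rintro rfl; norm_num at h12
  have hω3 := cube_eq_one_of_root hω
  have hχ3 : χ ^ 3 = 1 := mulChar_pow_eq_one_of_generator hg hω3 hχ
  have hω1 : ω ≠ 1 := by
    rintro rfl
    exact h3 (by linear_combination hω)
  have hω2 : ω ^ 2 ≠ 1 := fun h => hω1 (by linear_combination hω3 - ω * h)
  have hχ2 : (χ * χ) g = ω ^ 2 := by rw [MulChar.mul_apply, hχ, sq]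
  have hω' : (ω ^ 2) ^ 2 + ω ^ 2 + 1 = 0 := by linear_combination (ω ^ 2 - ω + 1) * hω
  have hne : χ ≠ 1 := mulChar_ne_one_of_generator hω1 hχ
  have hne2 : χ * χ ≠ 1 := mulChar_ne_one_of_generator hω2 hχ2
  have hχ4 : χ * χ * (χ * χ) = χ := by
    rw [← mul_assoc, ← sq, ← pow_succ, hχ3, one_mul]
  have hinv : χ⁻¹ = χ * χ := by rw [inv_eq_iff_mul_eq_one, ← hχ3, pow_succ', sq]
  have he := quadChar_apply_generator (K := K) hg hp2
  have hm1 : (-1 : K) ≠ 1 := fun h => h2 (by linear_combination -h)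
  have hene : quadChar p K ≠ 1 := mulChar_ne_one_of_generator hm1 he
  have hneg : χ (-1) = 1 := by
    have h : χ (-1) ^ 3 = 1 := by
      rw [← MulChar.pow_apply' _ (by norm_num), hχ3]
      exact MulChar.one_apply isUnit_one.neg
    rw [← h, ← map_pow]; norm_num
  have h41 : χ 4 = 1 := by
    obtain ⟨y, hy⟩ := h4
    have hy0 : y ≠ 0 := by
      rintro rfl
      have : ((4 : ℕ) : ZMod p) = 0 := by push_cast; rw [← hy]; norm_num
      rw [ZMod.natCast_eq_zero_iff, show 4 = 2 ^ 2 by norm_num] at this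
      exact hp2 ((Nat.prime_dvd_prime_iff_eq Fact.out Nat.prime_two).1
        ((Fact.out : p.Prime).dvd_of_dvd_pow this))
    rw [← hy, map_pow, ← MulChar.pow_apply' _ (by norm_num), hχ3]
    exact MulChar.one_apply (isUnit_iff_ne_zero.2 hy0)
  have h41' : (χ * χ) 4 = 1 := by rw [MulChar.mul_apply, h41, one_mul]
  have hJ := hab K ω χ hω hχ
  have hJ' := hab K (ω ^ 2) (χ * χ) hω' hχ2
  have hne_e : χ * quadChar p K ≠ 1 := by
    refine mulChar_ne_one_of_generator (g := g) (ζ := -ω) ?_ ?_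
    · intro h
      exact h2 (by linear_combination -(ω ^ 2 - ω + 1) * h - hω3)
    · rw [MulChar.mul_apply, hχ, he]; ring
  have hne_e2 : χ * χ * quadChar p K ≠ 1 := by
    refine mulChar_ne_one_of_generator (g := g) (ζ := -ω ^ 2) ?_ ?_
    · intro h
      exact h2 (by linear_combination -(ω ^ 4 - ω ^ 2 + 1) * h - (ω ^ 3 + 1) * hω3)
    · rw [MulChar.mul_apply, hχ2, he]; ring
  refine ⟨?_, ?_, ?_, ?_, ?_, ?_⟩
  · rw [← hinv]; exact gaussSum_mul_gaussSum_inv_eq_card hne hneg hψ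
  · rw [sq, ← jacobiSum_mul_nontrivial hne2, hJ, mul_comm]
  · have h := jacobiSum_mul_nontrivial (χ := χ * χ) (φ := χ * χ) (by rwa [hχ4]) ψ
    rw [sq, ← h, hχ4, hJ', mul_comm]
  · rw [← jacobiSum_mul_nontrivial hne_e, ← jacobiSum_self_eq_jacobiSum_quadChar hp2 hne h41, hJ,
      mul_comm]
  · rw [← jacobiSum_mul_nontrivial hne_e2, ← jacobiSum_self_eq_jacobiSum_quadChar hp2 hne2 h41',
      hJ', mul_comm]
  · rw [gaussSum_sq hene ((quadraticChar_isQuadratic (ZMod p)).comp _) hψ, ZMod.card]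
    have : quadChar p K (-1) = -1 := by
      have h1 := neg_one_eq_pow hg hp2
      have h2 := mulChar_apply_generator_pow he ((p - 1) / 2)
      rw [← h1] at h2
      rw [Units.val_neg, Units.val_one] at h2
      rw [h2]
      exact Odd.neg_one_pow (Nat.odd_iff.2 (by omega))
    rw [this]; ring

theorem six_mul_sum_hall (hg : ∀ u, u ∈ Subgroup.zpowers g) (h6 : 6 ∣ p - 1)
    (hω : ω ^ 2 + ω + 1 = 0) (hχ : χ g = ω) {e : MulChar (ZMod p) K} (he : e g = -1)
    (hψ : ψ ≠ 1) :
    6 * ∑ t, ((hall g t).val : K) * ψ t =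
      2 * (-1 + gaussSum χ ψ + gaussSum (χ * χ) ψ)
      + (-1 + ω ^ 2 * gaussSum χ ψ + ω * gaussSum (χ * χ) ψ)
      - (gaussSum e ψ + ω ^ 2 * gaussSum (χ * e) ψ + ω * gaussSum (χ * χ * e) ψ) := by
  rw [← gaussSum_one_left hψ]
  simp only [gaussSum, Finset.mul_sum, ← Finset.sum_add_distrib, ← Finset.sum_sub_distrib]
  refine Finset.sum_congr rfl fun t _ => ?_
  linear_combination ψ t * six_mul_hall_val hg h6 hω hχ he t

theorem three_mul_sum_gray_sub (hg : ∀ u, u ∈ Subgroup.zpowers g) (h12 : p % 12 = 7)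
    (hω : ω ^ 2 + ω + 1 = 0) (hχ : χ g = ω) (hψ : ψ ≠ 1) :
    3 * ∑ t, (((gray (hall g t) (hall g (-t))).val : K)
        - (gray (hall g t) (1 - hall g (-t))).val) * ψ t =
      2 * (-1 + ω ^ 2 * gaussSum χ ψ + ω * gaussSum (χ * χ) ψ) := by
  have h0 : 3 * ∑ t, ψ t = 0 := by rw [AddChar.sum_eq_zero_of_ne_one hψ, mul_zero]
  rw [← gaussSum_one_left hψ, ← sub_zero (2 * _), ← h0]
  simp only [gaussSum, Finset.mul_sum, ← Finset.sum_add_distrib, ← Finset.sum_sub_distrib]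
  refine Finset.sum_congr rfl fun t _ => ?_
  linear_combination ψ t * three_mul_gray_sub hg h12 hω hχ t

/-- Squaring the vanishing relation removes `Q` through `Q^2 = -P`. For `w = s(u - v)`, the
quadratic terms cancel against the formula for `w^2`, and what is left is linear in `w`; the cubic
is the period equation of `w`. -/
theorem relations_of_normalized_gaussSum {u v J J' s Q P b Z : K} (hP : P ≠ 0) (huv : u * v = P)
    (hu : u ^ 2 = J * v) (hv : v ^ 2 = J' * u) (hs : s ^ 2 = -3) (hJ : J - J' = b * s)
    (hQ : Q ^ 2 = -P) (hZ : P * Z = Q * (u ^ 2 + v ^ 2)) (h0 : s * (u - v) - 3 = Q + Z) :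
    9 * (P + 1) + (b - 6) * (s * (u - v)) = 0 ∧
      (s * (u - v)) ^ 3 = 9 * P * (s * (u - v)) + 9 * P * b := by
  have hJJ : J * J' = P := by
    apply mul_left_cancel₀ hP
    linear_combination (-J * J' + u * v + P) * huv - v ^ 2 * hu - J * v * hv
  have h1 : P * (s * (u - v) - 3) = Q * (P + u ^ 2 + v ^ 2) := by
    linear_combination P * h0 + hZ
  have h2 : P * (s * (u - v) - 3) ^ 2 + (P + u ^ 2 + v ^ 2) ^ 2 = 0 := by
    apply mul_left_cancel₀ hP
    linear_combination (P * (s * (u - v) - 3) + Q * (P + u ^ 2 + v ^ 2)) * h1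
      + (P + u ^ 2 + v ^ 2) ^ 2 * hQ
  have hw : (s * (u - v)) ^ 2 = -3 * (J * v + J' * u - 2 * P) := by
    linear_combination (u - v) ^ 2 * hs - 3 * hu - 3 * hv + 6 * huv
  have h4 : (P + u ^ 2 + v ^ 2) ^ 2 =
      P * (J * u + J' * v + 3 * P + 2 * (J * v + J' * u)) := by
    linear_combination (u ^ 2 + J * v + 2 * P) * hu + (v ^ 2 + J' * u + 2 * P) * hv
      + J ^ 2 * hv + J' ^ 2 * hu + (J * u + J' * v) * hJJ + 2 * (u * v + P) * huv
  refine ⟨?_, ?_⟩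
  · rw [h4, ← mul_add] at h2
    have h5 := (mul_eq_zero.1 h2).resolve_left hP
    linear_combination h5 - hw - (u - v) * hJ
  · linear_combination (s * (u - v) ^ 3) * hs - 3 * s * u * hu + 3 * s * v * hv
      - 3 * s * (J - J') * huv + 9 * s * (u - v) * huv - 3 * s * P * hJ - 3 * P * b * hs

/-- With `s = ω - ω^2`, one has `s(ω^2 G - ω H) = (2 + ω^2)G + (2 + ω)H`, which is exactly the cubic
part of the Hall sum. -/
theorem relations_of_sum_hall_eq_zero {G H Q A B P a b : K} (hω : ω ^ 2 + ω + 1 = 0)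
    (hP : P ≠ 0) (h1 : G * H = P) (h2 : G ^ 2 = (a + b * ω) * H)
    (h3 : H ^ 2 = (a + b * ω ^ 2) * G)
    (h4 : G * Q = (a + b * ω) * A) (h5 : H * Q = (a + b * ω ^ 2) * B) (h6 : Q ^ 2 = -P)
    (h0 : 2 * (-1 + G + H) + (-1 + ω ^ 2 * G + ω * H) - (Q + ω ^ 2 * A + ω * B) = 0) :
    ∃ w : K, 9 * (P + 1) + (b - 6) * w = 0 ∧ w ^ 3 = 9 * P * w + 9 * P * b := by
  have hG : G ≠ 0 := by rintro rfl; exact hP (by rw [← h1, zero_mul])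
  have hH : H ≠ 0 := by rintro rfl; exact hP (by rw [← h1, mul_zero])
  have hω3 := cube_eq_one_of_root hω
  have hA : P * A = Q * H ^ 2 := by
    apply mul_left_cancel₀ hG
    apply mul_left_cancel₀ hG
    linear_combination (P * A) * h2 - P * H * h4 - G * Q * H * h1
  have hB : P * B = Q * G ^ 2 := by
    apply mul_left_cancel₀ hH
    apply mul_left_cancel₀ hH
    linear_combination (P * B) * h3 - P * G * h5 - G * Q * H * h1
  refine ⟨_, relations_of_normalized_gaussSum (u := ω ^ 2 * G) (v := ω * H) (J := a + b * ω)
    (J' := a + b * ω ^ 2) (s := ω - ω ^ 2) (Q := Q) (P := P) (b := b) (Z := ω ^ 2 * A + ω * B)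
    hP ?_ ?_ ?_ ?_ ?_ h6 ?_ ?_⟩
  · linear_combination G * H * hω3 + h1
  · linear_combination ω * G ^ 2 * hω3 + ω * h2
  · linear_combination ω ^ 2 * h3
  · linear_combination (ω ^ 2 - 3 * ω + 3) * hω
  · ring
  · linear_combination ω ^ 2 * hA + ω * hB - Q * ω * G ^ 2 * hω3
  · linear_combination h0 - (G + H) * hω + (G - ω * G + H) * hω3

/-- Cube `ω^2 G + ω H = 1`, using `G^3 = P(a + bω)`, `H^3 = P(a + bω^2)` and `GH = P`. -/
theorem relation_of_cubic_period_eq_zero {G H P a b : K} (hω : ω ^ 2 + ω + 1 = 0)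
    (h1 : G * H = P) (h2 : G ^ 2 = (a + b * ω) * H)
    (h3' : H ^ 2 = (a + b * ω ^ 2) * G)
    (h0 : -1 + ω ^ 2 * G + ω * H = 0) :
    P * (2 * a - b + 3) - 1 = 0 := by
  have hω3 := cube_eq_one_of_root hω
  have hG3 : G ^ 3 = P * (a + b * ω) := by linear_combination G * h2 + (a + b * ω) * h1
  have hH3 : H ^ 3 = P * (a + b * ω ^ 2) := by linear_combination H * h3' + (a + b * ω ^ 2) * h1
  have hy : ω ^ 2 * G + ω * H = 1 := by linear_combination h0
  have hy3 : (ω ^ 2 * G + ω * H) ^ 3 = G ^ 3 + H ^ 3 + 3 * P * (ω ^ 2 * G + ω * H) := by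
    linear_combination (G ^ 3 * (ω ^ 3 + 1) + H ^ 3 + 3 * G * H * (ω ^ 2 * G + ω * H)) * hω3
      + 3 * (ω ^ 2 * G + ω * H) * h1
  rw [hy, hG3, hH3] at hy3
  linear_combination -hy3 - P * b * hω

end Evaluation

/-! ### Excluding the divisibilities by `q = 1 + 2pn`. -/

section Arithmetic

theorem eq_or_eq_of_mul_eq_sq : ∀ n < 58, ∀ x < 30,
    13 + 2 * n * (115 - 2 * n) = 4 * x ^ 2 + 27 → n = 35 ∨ n = 57 := by
  decide +kernel

/-- The survivors `n = 35` and `n = 57` give `p = 3163` and `p = 127`; the moduli are `1 + 2pn`. -/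
theorem pow_not_modEq_one_of_exceptional :
    16 ^ 3163 % 221411 ≠ 1 ∧ 16 ^ 127 % 14479 ≠ 1 := by
  decide +kernel

/-- The polynomial value occurring for a generator with `b = -6` has no prime divisor
`q ≡ 1 mod 2 p` with `16 ^ p ≡ 1 mod q`. -/
theorem not_dvd_cubic_value {p q n : ℕ} (hp : p.Prime) (hq : q.Prime) (hn : q = 1 + 2 * p * n)
    {x : ℤ} (hpx : (p : ℤ) = 4 * x ^ 2 + 27) (hpow : 16 ^ p % q = 1) :
    ¬ (q : ℤ) ∣ p ^ 3 - 13 * p ^ 2 + 115 * p + 1 := by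
  intro hdvd
  have hn1 : 1 ≤ n := by
    rcases Nat.eq_zero_or_pos n with rfl | h
    · rw [mul_zero, add_zero] at hn; exact (hq.one_lt.ne' hn).elim
    · exact h
  have hxp : p = 4 * x.natAbs ^ 2 + 27 := by
    zify; rw [sq_abs]; exact hpx
  generalize x.natAbs = y at hxp
  have hodd : p % 2 = 1 := by omega
  -- Below 5 only `p = 31` and `p = 43` are prime; factoring the cubic value settles them. Otherwise
  -- `p ≥ 127`, which the estimate for `t` requires.
  rcases Nat.lt_or_ge y 5 with hy | hy
  · interval_cases y
    · norm_num at hxp; subst hxp; norm_num at hp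
    · norm_num at hxp; subst hxp
      have h : q ∣ 2 ^ 7 * 163 := by zify; norm_num at hdvd ⊢; exact hdvd
      rcases hq.dvd_mul.1 h with h | h
      · have := (Nat.prime_dvd_prime_iff_eq hq Nat.prime_two).1 (hq.dvd_of_dvd_pow h)
        omega
      · have := (Nat.prime_dvd_prime_iff_eq hq (by norm_num)).1 h
        omega
    · norm_num at hxp; subst hxp
      have h : q ∣ 2 ^ 10 * 59 := by zify; norm_num at hdvd ⊢; exact hdvd
      rcases hq.dvd_mul.1 h with h | h
      · have := (Nat.prime_dvd_prime_iff_eq hq Nat.prime_two).1 (hq.dvd_of_dvd_pow h)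
        omega
      · have := (Nat.prime_dvd_prime_iff_eq hq (by norm_num)).1 h
        omega
    · norm_num at hxp; subst hxp; norm_num at hp
    · norm_num at hxp; subst hxp; norm_num at hp
  have hp127 : (127 : ℤ) ≤ p := by
    have : 25 ≤ y ^ 2 := by nlinarith
    omega
  obtain ⟨k, hk⟩ := hdvd
  have hqz : (q : ℤ) = 1 + 2 * p * n := by exact_mod_cast hn
  have hn1z : (1 : ℤ) ≤ n := by exact_mod_cast hn1
  rw [hqz] at hk
  -- Both `q` and the cubic value are 1 mod `p`, hence so is the cofactor: `k = 1 + pm`.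
  obtain ⟨m, hm⟩ : ∃ m : ℤ, m = (p : ℤ) ^ 2 - 13 * p + 115 - 2 * n * k := ⟨_, rfl⟩
  have hkm : k = 1 + p * m := by rw [hm]; linear_combination -hk
  have hkpos : 0 < k := by
    have h1 : 0 < (p : ℤ) ^ 3 - 13 * p ^ 2 + 115 * p + 1 := by nlinarith [sq_nonneg (p : ℤ)]
    rw [hk] at h1
    exact (mul_pos_iff_of_pos_left (by positivity)).1 h1
  have hm0 : 0 ≤ m := by
    by_contra h
    have : m ≤ -1 := by omega
    nlinarith
  have hm1 : 1 ≤ m := by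
    rcases hm0.eq_or_lt with h | h
    · exfalso
      rw [← h, mul_zero, add_zero] at hkm
      rw [hkm] at hk
      obtain ⟨r, hr⟩ : ∃ r : ℤ, (p : ℤ) = 2 * r + 1 := ⟨(p / 2 : ℕ), by omega⟩
      rw [hr] at hk
      have : (2 : ℤ) * (4 * r ^ 3 + 6 * r ^ 2 + 3 * r - 26 * r ^ 2 - 26 * r - 6 + 115 * r + 58
        - (2 * r + 1) * n) = 1 := by linear_combination hk
      omega
    · omega
  have heq : m + 2 * n + 2 * p * m * n = (p : ℤ) ^ 2 - 13 * p + 115 := by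
    rw [hkm] at hm
    linear_combination hm
  -- Reducing once more mod `p` gives `m + 2n - 115 = tp`. Size forces `t = 0`, so `m = 115 - 2n`
  -- and finitely many `n` remain.
  obtain ⟨t, ht⟩ : ∃ t : ℤ, t = p - 13 - 2 * m * n := ⟨_, rfl⟩
  have ht1 : m + 2 * n - 115 = t * p := by rw [ht]; linear_combination heq
  have ht0 : t = 0 := by
    have h1 : (m - 1) * (2 * n - 1) = p - 127 - t * (p + 1) := by
      linear_combination ht - ht1
    have h2 : 0 ≤ (m - 1) * (2 * n - 1) := mul_nonneg (by omega) (by omega)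
    have h3 : t < 1 := by
      by_contra h
      have : 1 ≤ t := by omega
      nlinarith
    have h4 : -1 < t := by
      by_contra h
      have : t ≤ -1 := by omega
      nlinarith
    omega
  rw [ht0, zero_mul] at ht1
  rw [ht0] at ht
  have hn58 : n < 58 := by omega
  have hm' : m = ((115 - 2 * n : ℕ) : ℤ) := by omega
  have hpn : p = 13 + 2 * n * (115 - 2 * n) := by
    zify
    rw [Nat.cast_sub (by omega)] at *
    push_cast at hm' ⊢
    rw [hm'] at ht
    linear_combination -ht
  have hy30 : y < 30 := by
    have : n * (115 - 2 * n) ≤ 57 * 30 := by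
      zify
      rw [Nat.cast_sub (by omega)]
      push_cast
      nlinarith [sq_nonneg ((n : ℤ) - 29)]
    by_contra h
    have : 900 ≤ y ^ 2 := by nlinarith
    rw [mul_assoc] at hpn
    omega
  rcases eq_or_eq_of_mul_eq_sq n hn58 y hy30 (hpn.symm.trans hxp) with rfl | rfl
  · norm_num at hpn
    subst hpn
    norm_num at hn
    subst hn
    exact pow_not_modEq_one_of_exceptional.1 hpow
  · norm_num at hpn
    subst hpn
    norm_num at hn
    subst hn
    exact pow_not_modEq_one_of_exceptional.2 hpow

/-- The cofactor is `-1 + pm`. For `m ≠ 0` the term `2pmn` exceeds what `|c| < 2p - 6` permits; for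
`m = 0` parity fails. -/
theorem not_dvd_cubic_period_norm {p q n : ℕ} (hq : q.Prime) (hn : q = 1 + 2 * p * n)
    {c : ℤ} (hc : c ^ 2 + 108 = 4 * p) : ¬ (q : ℤ) ∣ p * (c + 3) - 1 := by
  rintro ⟨k, hk⟩
  have hn1 : (1 : ℤ) ≤ n := by
    rcases Nat.eq_zero_or_pos n with rfl | h
    · rw [mul_zero, add_zero] at hn; exact (hq.one_lt.ne' hn).elim
    · exact_mod_cast h
  have hqz : (q : ℤ) = 1 + 2 * p * n := by exact_mod_cast hn
  have hceven : ∃ d, c = 2 * d := by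
    rcases Int.even_or_odd' c with ⟨d, hd | hd⟩
    · exact ⟨d, hd⟩
    · exfalso
      have : 4 * (d ^ 2 + d + 27 - p) = -1 := by rw [hd] at hc; linear_combination hc
      omega
  obtain ⟨d, rfl⟩ := hceven
  rw [hqz] at hk
  obtain ⟨m, hm⟩ : ∃ m : ℤ, m = 2 * d + 3 - 2 * n * k := ⟨_, rfl⟩
  have hkm : k = -1 + p * m := by rw [hm]; linear_combination -hk
  have heq : m - 2 * n + 2 * p * m * n = 2 * d + 3 := by rw [hkm] at hm; linear_combination hm
  have hp27 : (27 : ℤ) ≤ p := by nlinarith [sq_nonneg d]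
  have hd1 : |d| < p - 3 := by
    apply abs_lt_of_sq_lt_sq _ (by linarith)
    nlinarith
  obtain ⟨hd2, hd3⟩ := abs_lt.1 hd1
  rcases lt_trichotomy m 0 with h | h | h
  · have h1 : m ≤ -1 := by omega
    nlinarith [mul_nonneg (by linarith : (0 : ℤ) ≤ -1 - m) (by linarith : (0 : ℤ) ≤ n - 1)]
  · rw [h] at heq; omega
  · have h1 : 1 ≤ m := by omega
    nlinarith [mul_nonneg (by linarith : (0 : ℤ) ≤ m - 1) (by linarith : (0 : ℤ) ≤ n - 1)]

end Arithmetic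

/-! ### The value at 4 as a character sum. -/

section Value

theorem sum_range_two_mul {M : Type*} [AddCommMonoid M] (f : ℕ → M) (n : ℕ) :
    ∑ i ∈ Finset.range (2 * n), f i =
      ∑ j ∈ Finset.range n, f (2 * j) + ∑ j ∈ Finset.range n, f (2 * j + 1) := by
  induction n with
  | zero => simp
  | succ n ih =>
    rw [show 2 * (n + 1) = 2 * n + 1 + 1 by ring, Finset.sum_range_succ, Finset.sum_range_succ, ih,
      Finset.sum_range_succ, Finset.sum_range_succ]
    abel

theorem sum_range_natCast_zmod {M : Type*} [AddCommMonoid M] (n : ℕ) [NeZero n]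
    (f : ZMod n → M) : ∑ j ∈ Finset.range n, f (j : ZMod n) = ∑ t, f t := by
  refine Finset.sum_bij (fun j _ => (j : ZMod n)) (fun _ _ => Finset.mem_univ _) ?_ ?_
    (fun _ _ => rfl)
  · intro i hi j hj h
    rw [ZMod.natCast_eq_natCast_iff', Nat.mod_eq_of_lt (Finset.mem_range.1 hi),
      Nat.mod_eq_of_lt (Finset.mem_range.1 hj)] at h
    exact h
  · intro t _
    exact ⟨t.val, Finset.mem_range.2 t.val_lt, ZMod.natCast_zmod_val t⟩

/-- Evaluation of the interleaved sequence at `4` in a ring where `4 ^ n = ε` with `ε ^ 2 = 1`. -/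
theorem valueAtFour_interleave_cast {n : ℕ} [NeZero n] (hn : Odd n) {R : Type*} [CommRing R]
    {ε : R} (h4 : (4 : R) ^ n = ε) (hε : ε * ε = 1) (h16 : (16 : R) ^ n = 1)
    (a b : ZMod n → ZMod 2) :
    (valueAtFour (interleave a b) : R) =
      ∑ t, (((gray (a t) (b t)).val : R) + ε * (gray (a t) (1 - b t)).val) *
        AddChar.zmodChar n h16 t := by
  set ψ := AddChar.zmodChar n h16 with hψ
  have hψn : ∀ j : ℕ, ψ (j : ZMod n) = 16 ^ j := fun j => AddChar.zmodChar_apply' h16 j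
  have h1 : (valueAtFour (interleave a b) : R) = ∑ i ∈ Finset.range (2 * n),
      ((gray (if i % 2 = 0 then a ((i / 2 : ℕ) : ZMod n)
          else a (((n + 1) / 2 + i / 2 : ℕ) : ZMod n))
        (if i % 2 = 0 then b ((i / 2 : ℕ) : ZMod n)
          else 1 - b (((n + 1) / 2 + i / 2 : ℕ) : ZMod n))).val : R) * 4 ^ i := by
    rw [valueAtFour, ← Fin.sum_univ_eq_sum_range, Nat.cast_sum]
    refine Finset.sum_congr rfl fun i _ => ?_
    rw [Nat.cast_mul, Nat.cast_pow, Nat.cast_ofNat]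
    rfl
  rw [h1, sum_range_two_mul]
  have heven : ∀ j : ℕ, (2 * j) % 2 = 0 := fun j => by omega
  have hodd : ∀ j : ℕ, ¬ (2 * j + 1) % 2 = 0 := fun j => by omega
  have hdiv : ∀ j : ℕ, (2 * j) / 2 = j := fun j => by omega
  have hdiv' : ∀ j : ℕ, (2 * j + 1) / 2 = j := fun j => by omega
  simp only [heven, hodd, hdiv, hdiv', if_true, if_false]
  have h16' : ∀ j : ℕ, (4 : R) ^ (2 * j) = ψ j := fun j => by
    rw [hψn, pow_mul]; norm_num
  simp only [add_mul, Finset.sum_add_distrib]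
  congr 1
  · rw [← sum_range_natCast_zmod]
    exact Finset.sum_congr rfl fun j _ => by rw [h16']
  -- `16^((n+1)/2 + j) = 4^n · 4^(2j+1)`, so the weight at an odd position is `ε ψ` at the very
  -- index where `a` and `b` are read.
  · have hh : ∀ j : ℕ, (4 : R) ^ (2 * j + 1) = ε * ψ (((n + 1) / 2 + j : ℕ) : ZMod n) := by
      intro j
      rw [hψn, pow_add 16, show (16 : R) = 4 ^ 2 by norm_num, ← pow_mul, ← pow_mul,
        show 2 * ((n + 1) / 2) = n + 1 by obtain ⟨k, rfl⟩ := hn; omega, pow_succ 4 n, h4]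
      linear_combination (-4 * 4 ^ (2 * j) : R) * hε
    simp only [hh]
    have hs := sum_range_natCast_zmod n (fun t => ((gray (a (((n + 1) / 2 : ℕ) + t))
      (1 - b (((n + 1) / 2 : ℕ) + t))).val : R) * (ε * ψ (((n + 1) / 2 : ℕ) + t)))
    simp only [Nat.cast_add]
    refine hs.trans ?_
    refine (_root_.Equiv.sum_comp (Equiv.addLeft (((n + 1) / 2 : ℕ) : ZMod n))
      (fun t => ((gray (a t) (1 - b t)).val : R) * (ε * ψ t))).trans ?_
    exact Finset.sum_congr rfl fun t _ => by ring

/-- When `4^p = 1`, this makes the second sequence drop out of the value at 4. -/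
theorem gray_val_add (c d : ZMod 2) : (gray c d).val + (gray c (1 - d)).val = 4 * c.val + 1 := by
  revert c d; decide

end Value

/-! ### Sums with trivial additive character, needed at the primes 3 and 5. -/

section Counting

variable {p : ℕ} [Fact p.Prime] {g : (ZMod p)ˣ}

theorem two_mul_sum_hall_add_one (hg : ∀ u, u ∈ Subgroup.zpowers g) (h12 : p % 12 = 7) :
    2 * ∑ t, (hall g t).val + 1 = p := by
  have h6 : 6 ∣ p - 1 := by omega
  obtain ⟨ω, hω⟩ := exists_root_of_two_three (K := ℂ)
  have hω3 := cube_eq_one_of_root hω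
  obtain ⟨χ, hχ⟩ := exists_mulChar_apply_generator hg (show 3 ∣ p - 1 by omega) hω3
  have he := quadChar_apply_generator (K := ℂ) hg (by omega)
  have hω1 : ω ≠ 1 := by rintro rfl; norm_num at hω
  have hω2 : ω ^ 2 ≠ 1 := fun h => hω1 (by linear_combination hω3 - ω * h)
  have hχ2 : (χ * χ) g = ω ^ 2 := by rw [MulChar.mul_apply, hχ, sq]
  have key : ∀ (θ : MulChar (ZMod p) ℂ) (ζ : ℂ), ζ ≠ 1 → θ g = ζ → ∑ t, θ t = 0 :=
    fun θ ζ h1 h2 => MulChar.sum_eq_zero_of_ne_one (mulChar_ne_one_of_generator h1 h2)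
  have s1 := key χ ω hω1 hχ
  have s2 := key (χ * χ) (ω ^ 2) hω2 hχ2
  have s3 := key (quadChar p ℂ) (-1) (by norm_num) he
  have s4 := key (χ * quadChar p ℂ) (-ω) (fun h => two_ne_zero (α := ℂ)
    (by linear_combination -(ω ^ 2 - ω + 1) * h - hω3)) (by rw [MulChar.mul_apply, hχ, he]; ring)
  have s5 := key (χ * χ * quadChar p ℂ) (-ω ^ 2) (fun h => two_ne_zero (α := ℂ)
    (by linear_combination -(ω ^ 4 - ω ^ 2 + 1) * h - (ω ^ 3 + 1) * hω3))
    (by rw [MulChar.mul_apply, hχ2, he]; ring)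
  have s0 : ∑ t, (1 : MulChar (ZMod p) ℂ) t = ((p - 1 : ℕ) : ℂ) := by
    rw [MulChar.sum_one_eq_card_units, ZMod.card_units]
  have h := Finset.sum_congr (rfl : (Finset.univ : Finset (ZMod p)) = Finset.univ)
    fun t _ => six_mul_hall_val hg h6 hω hχ he t
  simp only [Finset.sum_add_distrib, Finset.sum_sub_distrib, ← Finset.mul_sum, s0, s1, s2, s3, s4,
    s5, mul_zero, add_zero, sub_zero] at h
  have h' : 6 * ∑ t, (hall g t).val = 2 * (p - 1) + (p - 1) := by exact_mod_cast h
  omega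

theorem three_mul_sum_gray_sub_int (hg : ∀ u, u ∈ Subgroup.zpowers g) (h12 : p % 12 = 7) :
    3 * ∑ t, (((gray (hall g t) (hall g (-t))).val : ℤ) - (gray (hall g t) (1 - hall g (-t))).val)
      = -p - 2 := by
  obtain ⟨ω, hω⟩ := exists_root_of_two_three (K := ℂ)
  have hω3 := cube_eq_one_of_root hω
  obtain ⟨χ, hχ⟩ := exists_mulChar_apply_generator hg (show 3 ∣ p - 1 by omega) hω3
  have hω1 : ω ≠ 1 := by rintro rfl; norm_num at hω
  have hω2 : ω ^ 2 ≠ 1 := fun h => hω1 (by linear_combination hω3 - ω * h)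
  have hχ2 : (χ * χ) g = ω ^ 2 := by rw [MulChar.mul_apply, hχ, sq]
  have s1 := MulChar.sum_eq_zero_of_ne_one (mulChar_ne_one_of_generator hω1 hχ)
  have s2 := MulChar.sum_eq_zero_of_ne_one (mulChar_ne_one_of_generator hω2 hχ2)
  have s0 : ∑ t, (1 : MulChar (ZMod p) ℂ) t = (p : ℂ) - 1 := by
    rw [MulChar.sum_one_eq_card_units, ZMod.card_units, Nat.cast_sub (by omega), Nat.cast_one]
  have h := Finset.sum_congr (rfl : (Finset.univ : Finset (ZMod p)) = Finset.univ)
    fun t _ => three_mul_gray_sub hg h12 hω hχ t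
  rw [← Finset.mul_sum] at h
  have hr : ∑ t, (2 * ((1 : MulChar (ZMod p) ℂ) t + ω ^ 2 * χ t + ω * (χ * χ) t) - 3)
      = -(p : ℂ) - 2 := by
    simp only [Finset.sum_add_distrib, Finset.sum_sub_distrib, ← Finset.mul_sum, s0, s1, s2,
      Finset.sum_const, Finset.card_univ, ZMod.card, nsmul_eq_mul]
    ring
  rw [hr] at h
  exact_mod_cast h

end Counting

/-! ### Prime divisors of the gcd. -/

section PrimeDivisors

theorem exists_eq_one_add_two_mul {p q : ℕ} (hp : p.Prime) (hq : q.Prime) (hp2 : p ≠ 2)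
    (hq2 : q ≠ 2) (h16 : (16 : ZMod q) ^ p = 1) (h1 : (16 : ZMod q) ≠ 1) :
    ∃ n, q = 1 + 2 * p * n := by
  have : Fact q.Prime := ⟨hq⟩
  have : Fact p.Prime := ⟨hp⟩
  have h0 : (16 : ZMod q) ≠ 0 := by
    intro h; rw [h, zero_pow hp.ne_zero] at h16; exact zero_ne_one h16
  have hord := ZMod.orderOf_dvd_card_sub_one h0
  rw [orderOf_eq_prime h16 h1] at hord
  have hq' := hq.eq_two_or_odd.resolve_left hq2
  have hcop : Nat.Coprime 2 p := (Nat.coprime_primes Nat.prime_two hp).2 hp2.symm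
  obtain ⟨n, hn⟩ := hcop.mul_dvd_of_dvd_of_dvd (show 2 ∣ q - 1 by omega) hord
  exact ⟨n, by have := hq.one_lt; omega⟩

theorem sixteen_ne_one {q : ℕ} (hq : q.Prime) (hq3 : q ≠ 3) (hq5 : q ≠ 5) :
    (16 : ZMod q) ≠ 1 := by
  intro h
  have h15 : ((15 : ℕ) : ZMod q) = 0 := by push_cast; linear_combination h
  rw [ZMod.natCast_eq_zero_iff, show 15 = 3 * 5 by norm_num] at h15
  rcases hq.dvd_mul.1 h15 with h | h
  · exact hq3 ((Nat.prime_dvd_prime_iff_eq hq Nat.prime_three).1 h)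
  · exact hq5 ((Nat.prime_dvd_prime_iff_eq hq Nat.prime_five).1 h)

variable {p : ℕ} {g : (ZMod p)ˣ} {x : ℤ}

theorem prime_mod_twelve (hx : x ≡ 1 [ZMOD 3]) (hpx : (p : ℤ) = 4 * x ^ 2 + 27) : p % 12 = 7 := by
  obtain ⟨r, hr⟩ := hx.symm.dvd
  have hxr : x = 3 * r + 1 := by linarith
  have : (p : ℤ) = 12 * (3 * r ^ 2 + 2 * r + 2) + 7 := by rw [hpx, hxr]; ring
  omega

/-- The integers `a`, `b` of the cubic Jacobi sum `a + b ω`, for `p = 4 x ^ 2 + 27`. -/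
theorem exists_jacobiSum_data [Fact p.Prime] (hg : ∀ u, u ∈ Subgroup.zpowers g) (h12 : p % 12 = 7)
    (hpx : (p : ℤ) = 4 * x ^ 2 + 27) :
    ∃ a b : ℤ, (∀ (K : Type) [Field K] (ω : K) (χ : MulChar (ZMod p) K),
      ω ^ 2 + ω + 1 = 0 → χ g = ω → jacobiSum χ χ = a + b * ω) ∧
      (2 * a - b) ^ 2 + 108 = 4 * p ∧ (b = 6 ∨ b = -6) ∧ ∃ y : ZMod p, y ^ 3 = 4 := by
  obtain ⟨a, b, hab⟩ := exists_int_jacobiSum_eq hg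
  obtain ⟨hnorm, hb3⟩ := jacobiSum_norm_and_three_dvd hg (by omega) hab
  have hb := eq_six_or_eq_neg_six_of_norm_eq Fact.out hpx hnorm hb3
  have hb2 : b ^ 2 = 36 := by rcases hb with rfl | rfl <;> norm_num
  have heven : Even b := by rcases hb with rfl | rfl <;> decide
  have hodd : Odd a := by
    rw [← Int.not_even_iff_odd]
    intro ha
    have h1 : Even (a ^ 2 - a * b + b ^ 2) :=
      ((ha.pow_of_ne_zero two_ne_zero).sub (ha.mul_right b)).add (heven.pow_of_ne_zero two_ne_zero)
    rw [hnorm, Int.even_iff] at h1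
    omega
  refine ⟨a, b, hab, ?_, hb, exists_cube_eq_four hg (by omega) (by omega) hab hodd heven⟩
  linear_combination 4 * hnorm - 3 * hb2

theorem sum_hall_ne_zero [Fact p.Prime] (hg : ∀ u, u ∈ Subgroup.zpowers g)
    (h12 : p % 12 = 7) (hpx : (p : ℤ) = 4 * x ^ 2 + 27) {q n : ℕ} (hq : q.Prime)
    (hn : q = 1 + 2 * p * n) (hpow : 16 ^ p % q = 1)
    {K : Type} [Field K] [IsAlgClosed K] [CharP K q] {ψ : AddChar (ZMod p) K}
    (hψ : ψ.IsPrimitive) : ∑ t, ((hall g t).val : K) * ψ t ≠ 0 := by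
  intro h0
  obtain ⟨a, b, hab, -, hb, h4⟩ := exists_jacobiSum_data hg h12 hpx
  have hp := (Fact.out : p.Prime)
  have hn1 : 1 ≤ n := by
    rcases Nat.eq_zero_or_pos n with rfl | h
    · rw [mul_zero, add_zero] at hn; exact (hq.one_lt.ne' hn).elim
    · exact h
  have hpq : p + 1 < q := by rw [hn]; nlinarith [hp.two_le]
  have hcast : ∀ r : ℕ, 0 < r → r < q → (r : K) ≠ 0 := fun r h1 h2 h =>
    absurd (Nat.le_of_dvd h1 ((CharP.cast_eq_zero_iff K q r).1 h)) (by omega)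
  have h2 : (2 : K) ≠ 0 := by exact_mod_cast hcast 2 (by norm_num) (by omega)
  have h3 : (3 : K) ≠ 0 := by exact_mod_cast hcast 3 (by norm_num) (by omega)
  have hP : (p : K) ≠ 0 := hcast p hp.pos (by omega)
  obtain ⟨ω, hω⟩ := exists_root_of_two_three (K := K)
  obtain ⟨χ, hχ⟩ := exists_mulChar_apply_generator hg (show 3 ∣ p - 1 by omega)
    (cube_eq_one_of_root hω)
  have hψ1 : ψ ≠ 1 := by
    rintro rfl
    exact hψ one_ne_zero (by ext; simp)
  have he := quadChar_apply_generator (K := K) hg (by omega)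
  have h6 := six_mul_sum_hall hg (by omega) hω hχ he hψ1
  rw [h0, mul_zero] at h6
  obtain ⟨r1, r2, r3, r4, r5, r6⟩ := gaussSum_relations hg h12 h2 h3 hω hχ hψ h4 hab
  obtain ⟨w, hw1, hw2⟩ := relations_of_sum_hall_eq_zero hω hP r1 r2 r3 r4 r5 r6 h6.symm
  have h9 : (9 : K) ≠ 0 := by
    rw [show (9 : K) = 3 * 3 by norm_num]; exact mul_ne_zero h3 h3
  -- The sign of `b` depends on `g`. For `b = 6` the linear relation gives `q ∣ p + 1 < q`; for `b =
  -- -6` it gives `w = 3(p + 1)/4`, and the cubic becomes `p^3 - 13p^2 + 115p + 1 = 0`.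
  rcases hb with rfl | rfl
  · have : ((p + 1 : ℕ) : K) = 0 := by
      push_cast at hw1 ⊢
      refine (mul_eq_zero.1 ?_).resolve_left h9
      linear_combination hw1
    exact hcast (p + 1) (by omega) hpq this
  · push_cast at hw1 hw2
    have h4w : 3 * ((p : K) + 1) = 4 * w := by
      apply mul_left_cancel₀ h3
      linear_combination hw1
    apply not_dvd_cubic_value hp hq hn hpx hpow
    rw [← CharP.intCast_eq_zero_iff K q]
    push_cast
    have h27 : (27 : K) ≠ 0 := by
      rw [show (27 : K) = 9 * 3 by norm_num]; exact mul_ne_zero h9 h3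
    apply mul_left_cancel₀ h27
    linear_combination 64 * hw2 + (9 * (p + 1) ^ 2 + 12 * (p + 1) * w + 16 * w ^ 2
      - 144 * p) * h4w

theorem sum_gray_sub_ne_zero [Fact p.Prime] (hg : ∀ u, u ∈ Subgroup.zpowers g)
    (h12 : p % 12 = 7) (hpx : (p : ℤ) = 4 * x ^ 2 + 27) {q n : ℕ} (hq : q.Prime)
    (hn : q = 1 + 2 * p * n) (hq3 : q ≠ 3)
    {K : Type} [Field K] [IsAlgClosed K] [CharP K q] {ψ : AddChar (ZMod p) K}
    (hψ : ψ.IsPrimitive) :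
    ∑ t, (((gray (hall g t) (hall g (-t))).val : K)
        - (gray (hall g t) (1 - hall g (-t))).val) * ψ t ≠ 0 := by
  intro h0
  obtain ⟨a, b, hab, hc, -, h4⟩ := exists_jacobiSum_data hg h12 hpx
  have hodd : q ≠ 2 := by
    rintro rfl
    rw [mul_assoc] at hn
    omega
  have hcast : ∀ r : ℕ, r.Prime → q ≠ r → (r : K) ≠ 0 := fun r hr h1 h =>
    h1 ((Nat.prime_dvd_prime_iff_eq hq hr).1 ((CharP.cast_eq_zero_iff K q r).1 h))
  have h2 : (2 : K) ≠ 0 := by exact_mod_cast hcast 2 Nat.prime_two hodd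
  have h3 : (3 : K) ≠ 0 := by exact_mod_cast hcast 3 Nat.prime_three hq3
  obtain ⟨ω, hω⟩ := exists_root_of_two_three (K := K)
  obtain ⟨χ, hχ⟩ := exists_mulChar_apply_generator hg (show 3 ∣ p - 1 by omega)
    (cube_eq_one_of_root hω)
  have hψ1 : ψ ≠ 1 := by
    rintro rfl
    exact hψ one_ne_zero (by ext; simp)
  have h6 := three_mul_sum_gray_sub hg h12 hω hχ hψ1
  rw [h0, mul_zero] at h6
  obtain ⟨r1, r2, r3, -⟩ := gaussSum_relations hg h12 h2 h3 hω hχ hψ h4 hab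
  have h7 := relation_of_cubic_period_eq_zero hω r1 r2 r3 ((mul_eq_zero.1 h6.symm).resolve_left h2)
  apply not_dvd_cubic_period_norm hq hn hc
  rw [← CharP.intCast_eq_zero_iff K q]
  push_cast
  exact h7

theorem isPrimitive_zmodChar_sixteen [Fact p.Prime] {K : Type*} [Field K] (h16 : (16 : K) ^ p = 1)
    (h1 : (16 : K) ≠ 1) : (AddChar.zmodChar p h16).IsPrimitive :=
  AddChar.zmodChar_primitive_of_primitive_root p
    (IsPrimitiveRoot.iff_orderOf.2 (orderOf_eq_prime h16 h1))

/-- The quaternary sequence interleaved by the Hall sequence and its reflection. -/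
noncomputable def interleavedHall {p : ℕ} (g : (ZMod p)ˣ) : Fin (2 * p) → ZMod 4 :=
  interleave (hall g) (sample (-1) (hall g))

theorem sample_neg_one_hall (t : ZMod p) : sample (-1) (hall g) t = hall g (-t) := by
  simp [sample]

theorem valueAtFour_cast_of_pow_eq_one [Fact p.Prime] (hp2 : p ≠ 2) {R : Type*} [CommRing R]
    (h4 : (4 : R) ^ p = 1) (h16 : (16 : R) ^ p = 1) :
    (valueAtFour (interleavedHall g) : R) =
      ∑ t, (4 * ((hall g t).val : R) + 1) * AddChar.zmodChar p h16 t := by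
  rw [interleavedHall, valueAtFour_interleave_cast ((Fact.out : p.Prime).odd_of_ne_two hp2) h4
    (one_mul 1) h16]
  refine Finset.sum_congr rfl fun t _ => ?_
  rw [one_mul, ← Nat.cast_add, gray_val_add]
  push_cast
  rfl

theorem valueAtFour_cast_of_pow_eq_neg_one [Fact p.Prime] (hp2 : p ≠ 2) {R : Type*} [CommRing R]
    (h4 : (4 : R) ^ p = -1) (h16 : (16 : R) ^ p = 1) :
    (valueAtFour (interleavedHall g) : R) =
      ∑ t, (((gray (hall g t) (hall g (-t))).val : R)
        - (gray (hall g t) (1 - hall g (-t))).val) * AddChar.zmodChar p h16 t := by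
  rw [interleavedHall, valueAtFour_interleave_cast ((Fact.out : p.Prime).odd_of_ne_two hp2) h4
    (by ring) h16]
  refine Finset.sum_congr rfl fun t _ => ?_
  rw [sample_neg_one_hall, neg_one_mul, ← sub_eq_add_neg]

/-- At `q = 3` the character is trivial and the value is `4(p - 1)/2 + p = 3p - 2`. For the other
`q` the constant 1 sums to zero against `ψ`, leaving the Hall sum. -/
theorem not_dvd_valueAtFour_of_dvd_sub_one [Fact p.Prime] (hg : ∀ u, u ∈ Subgroup.zpowers g)
    (h12 : p % 12 = 7) (hpx : (p : ℤ) = 4 * x ^ 2 + 27) {q : ℕ} (hq : q.Prime)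
    (hdvd : (4 : ZMod q) ^ p = 1) : ¬ q ∣ valueAtFour (interleavedHall g) := by
  have hp := (Fact.out : p.Prime)
  intro hval
  have h16 : (16 : ZMod q) ^ p = 1 := by
    rw [show (16 : ZMod q) = 4 ^ 2 by norm_num, ← pow_mul, mul_comm, pow_mul, hdvd, one_pow]
  have hq2 : q ≠ 2 := by
    rintro rfl
    rw [show (4 : ZMod 2) = 0 by decide, zero_pow hp.ne_zero] at hdvd
    exact zero_ne_one hdvd
  have hq5 : q ≠ 5 := by
    rintro rfl
    rw [show (4 : ZMod 5) = -1 by decide, Odd.neg_one_pow (hp.odd_of_ne_two (by omega))] at hdvd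
    exact absurd hdvd (by decide)
  rw [← ZMod.natCast_eq_zero_iff] at hval
  by_cases hq3 : q = 3
  · subst hq3
    rw [valueAtFour_cast_of_pow_eq_one (by omega) hdvd h16] at hval
    have h1 : ∀ t, AddChar.zmodChar p h16 t = 1 := fun t => by
      rw [AddChar.zmodChar_apply, show (16 : ZMod 3) = 1 by decide, one_pow]
    simp only [h1, mul_one, Finset.sum_add_distrib, ← Finset.mul_sum, Finset.sum_const,
      Finset.card_univ, ZMod.card, nsmul_eq_mul] at hval
    have h2 : ((4 * ∑ t, (hall g t).val + p : ℕ) : ZMod 3) = 0 := by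
      push_cast; exact hval
    rw [ZMod.natCast_eq_zero_iff] at h2
    have h3 := two_mul_sum_hall_add_one hg h12
    omega
  · have h161 := sixteen_ne_one hq hq3 hq5
    obtain ⟨n, hn⟩ := exists_eq_one_add_two_mul hp hq (by omega) hq2 h16 h161
    have : Fact q.Prime := ⟨hq⟩
    obtain ⟨K, _, _, ⟨f⟩⟩ : ∃ (K : Type) (_ : Field K) (_ : IsAlgClosed K),
        Nonempty (ZMod q →+* K) :=
      ⟨AlgebraicClosure (ZMod q), inferInstance, inferInstance, ⟨algebraMap _ _⟩⟩
    have : CharP K q := charP_of_injective_ringHom f.injective q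
    have f4 : f 4 = 4 := map_ofNat f 4
    have f16 : f 16 = 16 := map_ofNat f 16
    have k4 : (4 : K) ^ p = 1 := by simpa [f4] using congrArg f hdvd
    have k16 : (16 : K) ^ p = 1 := by simpa [f16] using congrArg f h16
    have k161 : (16 : K) ≠ 1 := fun h => h161 (f.injective (by simpa [f16] using h))
    have hψ := isPrimitive_zmodChar_sixteen k16 k161
    have hval' : (valueAtFour (interleavedHall g) : K) = 0 := by simpa using congrArg f hval
    rw [valueAtFour_cast_of_pow_eq_one (by omega) k4 k16] at hval'
    have hψ1 : AddChar.zmodChar p k16 ≠ 1 := by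
      intro h
      exact hψ one_ne_zero (by rw [h]; ext; simp)
    simp only [add_mul, one_mul, Finset.sum_add_distrib, AddChar.sum_eq_zero_of_ne_one hψ1,
      add_zero, mul_assoc, ← Finset.mul_sum] at hval'
    have h40 : (4 : K) ≠ 0 := by
      intro h; rw [h, zero_pow hp.ne_zero] at k4; exact zero_ne_one k4
    have hpow : 16 ^ p % q = 1 := by
      have : ((16 ^ p : ℕ) : ZMod q) = ((1 : ℕ) : ZMod q) := by push_cast; exact h16
      rw [ZMod.natCast_eq_natCast_iff'] at this
      rw [this, Nat.mod_eq_of_lt hq.one_lt]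
    exact sum_hall_ne_zero hg h12 hpx hq hn hpow hψ
      ((mul_eq_zero.1 hval').resolve_left h40)

/-- Mod 5 one has `16 = 1`, and the value is congruent to `-(p + 2)/3`. -/
theorem five_dvd_valueAtFour_iff [Fact p.Prime] (hg : ∀ u, u ∈ Subgroup.zpowers g)
    (h12 : p % 12 = 7) : 5 ∣ valueAtFour (interleavedHall g) ↔ p ≡ 3 [MOD 5] := by
  have hp := (Fact.out : p.Prime)
  have h4 : (4 : ZMod 5) ^ p = -1 := by
    rw [show (4 : ZMod 5) = -1 by decide, Odd.neg_one_pow (hp.odd_of_ne_two (by omega))]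
  have h16 : (16 : ZMod 5) ^ p = 1 := by rw [show (16 : ZMod 5) = 1 by decide, one_pow]
  have h1 : ∀ t, AddChar.zmodChar p h16 t = 1 := fun t => by
    rw [AddChar.zmodChar_apply, show (16 : ZMod 5) = 1 by decide, one_pow]
  rw [← ZMod.natCast_eq_zero_iff, valueAtFour_cast_of_pow_eq_neg_one (by omega) h4 h16]
  simp only [h1, mul_one]
  have h3 := three_mul_sum_gray_sub_int hg h12
  set S : ℤ := ∑ t, (((gray (hall g t) (hall g (-t))).val : ℤ)
    - (gray (hall g t) (1 - hall g (-t))).val) with hS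
  have hcast : ∑ t, (((gray (hall g t) (hall g (-t))).val : ZMod 5)
    - (gray (hall g t) (1 - hall g (-t))).val) = (S : ZMod 5) := by
    rw [hS]; push_cast; rfl
  rw [hcast, ZMod.intCast_zmod_eq_zero_iff_dvd, Nat.ModEq]
  omega

theorem eq_five_of_dvd_valueAtFour_of_dvd_add_one [Fact p.Prime]
    (hg : ∀ u, u ∈ Subgroup.zpowers g) (h12 : p % 12 = 7) (hpx : (p : ℤ) = 4 * x ^ 2 + 27) {q : ℕ}
    (hq : q.Prime) (hdvd : (4 : ZMod q) ^ p = -1) (hval : q ∣ valueAtFour (interleavedHall g)) :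
    q = 5 := by
  have hp := (Fact.out : p.Prime)
  by_contra hq5
  have h16 : (16 : ZMod q) ^ p = 1 := by
    rw [show (16 : ZMod q) = 4 ^ 2 by norm_num, ← pow_mul, mul_comm, pow_mul, hdvd]; ring
  have hq2 : q ≠ 2 := by
    rintro rfl
    rw [show (4 : ZMod 2) = 0 by decide, zero_pow hp.ne_zero] at hdvd
    exact absurd hdvd (by decide)
  have hq3 : q ≠ 3 := by
    rintro rfl
    rw [show (4 : ZMod 3) = 1 by decide, one_pow] at hdvd
    exact absurd hdvd (by decide)
  rw [← ZMod.natCast_eq_zero_iff] at hval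
  have h161 := sixteen_ne_one hq hq3 hq5
  obtain ⟨n, hn⟩ := exists_eq_one_add_two_mul hp hq (by omega) hq2 h16 h161
  have : Fact q.Prime := ⟨hq⟩
  obtain ⟨K, _, _, ⟨f⟩⟩ : ∃ (K : Type) (_ : Field K) (_ : IsAlgClosed K),
      Nonempty (ZMod q →+* K) :=
    ⟨AlgebraicClosure (ZMod q), inferInstance, inferInstance, ⟨algebraMap _ _⟩⟩
  have : CharP K q := charP_of_injective_ringHom f.injective q
  have f4 : f 4 = 4 := map_ofNat f 4
  have f16 : f 16 = 16 := map_ofNat f 16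
  have k4 : (4 : K) ^ p = -1 := by simpa [f4] using congrArg f hdvd
  have k16 : (16 : K) ^ p = 1 := by simpa [f16] using congrArg f h16
  have k161 : (16 : K) ≠ 1 := fun h => h161 (f.injective (by simpa [f16] using h))
  have hval' : (valueAtFour (interleavedHall g) : K) = 0 := by simpa using congrArg f hval
  rw [valueAtFour_cast_of_pow_eq_neg_one (by omega) k4 k16] at hval'
  exact sum_gray_sub_ne_zero hg h12 hpx hq hn hq3 (isPrimitive_zmodChar_sixteen k16 k161) hval'

theorem gcd_valueAtFour [Fact p.Prime] (hg : ∀ u, u ∈ Subgroup.zpowers g) (h12 : p % 12 = 7)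
    (hpx : (p : ℤ) = 4 * x ^ 2 + 27) :
    Nat.gcd (valueAtFour (interleavedHall g)) (4 ^ (2 * p) - 1) =
      if p ≡ 3 [MOD 5] then 5 else 1 := by
  have hprime : ∀ q : ℕ, q.Prime → q ∣ Nat.gcd (valueAtFour (interleavedHall g)) (4 ^ (2 * p) - 1) →
      q = 5 ∧ p ≡ 3 [MOD 5] := by
    intro q hq hdvd
    have : Fact q.Prime := ⟨hq⟩
    obtain ⟨h1, h2⟩ := Nat.dvd_gcd_iff.1 hdvd
    have h3 : ((4 : ZMod q) ^ p) * (4 ^ p) = 1 := by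
      rw [← ZMod.natCast_eq_zero_iff, Nat.cast_sub (Nat.one_le_pow _ _ (by norm_num))] at h2
      push_cast at h2
      rw [← pow_add, ← two_mul]
      linear_combination h2
    rcases mul_self_eq_one_iff.1 h3 with h | h
    · exact (not_dvd_valueAtFour_of_dvd_sub_one hg h12 hpx hq h h1).elim
    · obtain rfl := eq_five_of_dvd_valueAtFour_of_dvd_add_one hg h12 hpx hq h h1
      exact ⟨rfl, (five_dvd_valueAtFour_iff hg h12).1 h1⟩
  split_ifs with h5
  -- `4^10 ≡ 1` and `4^6 ≡ 21` mod 25, so 25 does not divide `4^(2p) - 1` and the gcd is exactly 5.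
  · have hpow : (4 : ℕ) ^ (2 * p) % 25 = 21 := by
      have hp5 : p = 5 * (p / 5) + 3 := by
        have : p % 5 = 3 := h5
        omega
      rw [hp5, pow_mul, pow_add, pow_mul, Nat.mul_mod, Nat.pow_mod]
      norm_num
    have h4dvd : 5 ∣ 4 ^ (2 * p) - 1 := by omega
    obtain ⟨r, hr⟩ := Nat.dvd_gcd ((five_dvd_valueAtFour_iff hg h12).2 h5) h4dvd
    have hr1 : r = 1 := by
      rw [Nat.eq_one_iff_not_exists_prime_dvd]
      intro q hq hqr
      obtain ⟨rfl, -⟩ := hprime q hq (hr ▸ hqr.mul_left 5)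
      obtain ⟨s, rfl⟩ := hqr
      have : 5 * (5 * s) ∣ 4 ^ (2 * p) - 1 := hr ▸ Nat.gcd_dvd_right _ _
      have h25 : 25 ∣ 4 ^ (2 * p) - 1 := (Dvd.intro s (by ring)).trans this
      generalize 4 ^ (2 * p) = X at hpow h25
      omega
    rw [hr, hr1]
  · rw [Nat.eq_one_iff_not_exists_prime_dvd]
    intro q hq hdvd
    exact h5 (hprime q hq hdvd).2

end PrimeDivisors

end InterleavedQuaternary

theorem mainTheorem5 (p : ℕ) (hp : p.Prime) (x : ℤ) (hx : x ≡ 1 [ZMOD 3])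
    (hpx : (p : ℤ) = 4 * x ^ 2 + 27) (g : (ZMod p)ˣ)
    (hg : ∀ u : (ZMod p)ˣ, u ∈ Subgroup.zpowers g) :
    (p ≡ 3 [MOD 5] →
      InterleavedQuaternary.fourAdicComplexity
        (InterleavedQuaternary.interleave (InterleavedQuaternary.hall g)
          (InterleavedQuaternary.sample (-1) (InterleavedQuaternary.hall g))) =
        Real.logb 4 (((4 : ℝ) ^ (2 * p) - 1) / 5)) ∧
    (¬ p ≡ 3 [MOD 5] →
      InterleavedQuaternary.fourAdicComplexity
        (InterleavedQuaternary.interleave (InterleavedQuaternary.hall g)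
          (InterleavedQuaternary.sample (-1) (InterleavedQuaternary.hall g))) =
        Real.logb 4 ((4 : ℝ) ^ (2 * p) - 1)) := by
  have : Fact p.Prime := ⟨hp⟩
  have hgcd := InterleavedQuaternary.gcd_valueAtFour hg
    (InterleavedQuaternary.prime_mod_twelve hx hpx) hpx
  rw [InterleavedQuaternary.interleavedHall] at hgcd
  constructor <;> intro h <;>
    simp [InterleavedQuaternary.fourAdicComplexity, hgcd, h]
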